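/- **Setting.** Let $q,m\in\mathbb N$, $n=n_1+\dots+n_q$, $A\in\mathbb R^{n\times n}$, $B\in\mathbb R^{n\times m}$, $K\in\mathbb R^{m\times n}$, $\bar u\in\mathbb R^m$ with $\bar u_i>0$, and $0<T_1^{(i)}\le T_2^{(i)}$ for $i=1,\dots,q$. Vectors of $\mathbb R^n$ are split into blocks, $\tilde\eta=(\tilde\eta^{(1)},\dots,\tilde\eta^{(q)})$ with $\tilde\eta^{(i)}\in\mathbb R^{n_i}$. Put $\mathrm{sat}_{\bar u}(v)_i=\min(|v_i|,\bar u_i)\,\mathrm{sign}(v_i)$, $\mathrm{dz}_{\bar u}(v)=\mathrm{sat}_{\bar u}(v)-v$, $\mathcal T=\prod_{i=1}^q[0,T_2^{(i)}]$, $\mathcal D_i=\{\tau\in\mathcal T:\tau_i=0\}$, and $$A_{cl}=\begin{bmatrix}A+BK&-BK\\0&A\end{bmatrix},\quad B_{cl}=\begin{bmatrix}B\\0\end{bmatrix},\quad K_{cl}=\begin{bmatrix}K&-K\end{bmatrix}.$$ Consider the hybrid system $\mathcal H$ with state $x=(\bar x,\tau)\in\mathbb R^{2n}\times\mathbb R^q$,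 $\bar x=(x_p,\tilde\eta)\in\mathbb R^n\times\mathbb R^n$: * flows $\dot{\bar x}=A_{cl}\bar x+B_{cl}\,\mathrm{dz}_{\bar u}(K_{cl}\bar x)$, $\dot\tau=-(1,\dots,1)$ on $\mathcal C=\mathbb R^{2n}\times\mathcal T$; * jumps on $\mathcal D=\mathbb R^{2n}\times\bigcup_i\mathcal D_i$: for some $i$ with $\tau\in\mathcal D_i$, $x_p^+=x_p$; $\tilde\eta^+$ is obtained from $\tilde\eta$ by setting its $i$-th block $\tilde\eta^{(i)}$ to $0$; $\tau_i^+\in[T_1^{(i)},T_2^{(i)}]$ is arbitrary and $\tau_k^+=\tau_k$ for $k\ne i$. Solutions $\phi=\phi(t,j)$ are hybrid arcs (on hybrid time domains, locally absolutely continuous in $t$) in the usual sense of Goebel, Sanfelice and Teel; a solution is maximal if it has no proper extension to another solution, and complete if $\operatorname{dom}\phi$ is unbounded. Let $\mathcal A=\{0\}\times\mathcal T$ and $|x|_{\mathcal A}=\inf_{y\in\mathcal A}|x-y|$ (Euclidean norm). The set $\mathcal A$ is *exponentially stable* if there are $\kappa,\lambda,\mu>0$ such that every maximal solution $\phi$ with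 $|\phi(0,0)|_{\mathcal A}\le\mu$ is complete and satisfies $|\phi(t,j)|_{\mathcal A}\le\kappa e^{-\lambda(t+j)}|\phi(0,0)|_{\mathcal A}$ for all $(t,j)\in\operatorname{dom}\phi$. The *basin of attraction* of $\mathcal A$ is the set of points from which each maximal solution is complete and converges to $\mathcal A$. **Theorem.** Suppose that there are symmetric positive definite matrices $W\in\mathbb R^{n\times n}$ and $R_i\in\mathbb R^{n_i\times n_i}$ ($i=1,\dots,q$), a diagonal positive definite $S\in\mathbb R^{m\times m}$, scalars $\sigma_1,\dots,\sigma_q>0$ and $\bar\mu>0$, and matrices $Z,J\in\mathbb R^{m\times n}$ such that, with $Z_{(i)},J_{(i)}$ the $i$-th rows of $Z,J$, $$\begin{bmatrix}W&0&Z_{(i)}^{\mathsf T}\\ \star&\bigoplus_{j=1}^qR_j&J_{(i)}^{\mathsf T}\\ \star&\star&\bar u_i^2/\bar\mu\end{bmatrix}\succeq0\qquad(i=1,\dots,m),$$ and such that, with $R(\tau)=\bigoplus_{j=1}^q e^{\sigma_j\tau_j}R_j$, $\Sigma=\bigoplus_{j=1}^q\sigma_jI_{n_j}$ and $\operatorname{He}(M)=M+M^{\mathsf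 T}$, for all $\tau\in\mathcal T$, $$\mathfrak M(\tau)=\begin{bmatrix}\operatorname{He}((A+BK)W)&-BK&BS-WK^{\mathsf T}-Z^{\mathsf T}\\ \star&\operatorname{He}(R(\tau)A)-\Sigma R(\tau)&K^{\mathsf T}-J^{\mathsf T}\\ \star&\star&-2S\end{bmatrix}\prec0 .$$ Then $\mathcal A$ is exponentially stable for $\mathcal H$, and the set $$\mathcal Q_{\bar\mu}=\{(\bar x,\tau)\in\mathcal C:\ \bar x^{\mathsf T}(W^{-1}\oplus R(\tau))\bar x\le\bar\mu\}$$ is contained in the basin of attraction of $\mathcal A$. In particular, there are $\lambda,\kappa>0$ such that every maximal solution $\phi$ of $\mathcal H$ with $\phi(0,0)\in\mathcal Q_{\bar\mu}$ satisfies $$|\phi(t,j)|_{\mathcal A}\le\kappa e^{-\lambda(t+j)}|\phi(0,0)|_{\mathcal A}\qquad\text{for all }(t,j)\in\operatorname{dom}\phi .$$ -/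

import Mathlib

open Matrix

noncomputable section

/-! ### Hybrid systems -/

/-- Data of a hybrid system `ẋ = f x` on `C`, `x⁺ ∈ G x` on `D`. -/
structure HybridSystem (X : Type*) where
  /-- flow map -/
  f : X → X
  /-- flow set -/
  C : Set X
  /-- (set-valued) jump map -/
  G : X → Set X
  /-- jump set -/
  D : Set X

/-- Compact hybrid time domains: `⋃_{j < J} [t_j, t_{j+1}] × {j}` with
`0 = t_0 ≤ t_1 ≤ ⋯ ≤ t_J`. -/
def IsCompactHybridTimeDomain (E : Set (ℝ × ℕ)) : Prop :=
  ∃ (J : ℕ) (t : ℕ → ℝ), t 0 = 0 ∧ Monotone t ∧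
    E = {p | p.2 < J ∧ p.1 ∈ Set.Icc (t p.2) (t (p.2 + 1))}

/-- Hybrid time domains: nonempty sets all of whose truncations
`E ∩ ([0, T] × {0, …, J})`, `(T, J) ∈ E`, are compact hybrid time domains.  Equivalently, unions of
a finite or infinite sequence of intervals `[t_j, t_{j+1}] × {j}`, the last one (if any) possibly
being of the form `[t_j, T)` with `T` finite or infinite. -/
def IsHybridTimeDomain (E : Set (ℝ × ℕ)) : Prop :=
  E.Nonempty ∧ (∀ p ∈ E, 0 ≤ p.1) ∧
    ∀ p ∈ E, IsCompactHybridTimeDomain (E ∩ {r | r.1 ≤ p.1 ∧ r.2 ≤ p.2})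

/-- A hybrid arc.  Only the values `φ.val t j` with `(t, j) ∈ φ.dom` are meaningful. -/
structure HybridArc (X : Type*) [PseudoMetricSpace X] where
  /-- the domain -/
  dom : Set (ℝ × ℕ)
  /-- the values -/
  val : ℝ → ℕ → X
  isHybridTimeDomain : IsHybridTimeDomain dom
  /-- `φ(·, j)` is locally absolutely continuous on `{t | (t, j) ∈ dom φ}` -/
  locallyAbsolutelyContinuous : ∀ (j : ℕ) (a b : ℝ), a ≤ b →
    (∀ t ∈ Set.Icc a b, (t, j) ∈ dom) → AbsolutelyContinuousOnInterval (fun t => val t j) a b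

/-- The interval of ordinary times `t` with `(t, j) ∈ dom φ`. -/
def HybridArc.interval {X : Type*} [PseudoMetricSpace X] (φ : HybridArc X) (j : ℕ) : Set ℝ :=
  {t | (t, j) ∈ φ.dom}

/-- A hybrid arc is complete if its domain is unbounded. -/
def HybridArc.IsComplete {X : Type*} [PseudoMetricSpace X] (φ : HybridArc X) : Prop :=
  ¬ Bornology.IsBounded φ.dom

/-- `φ` converges to the set `S`: `|φ(t, j)|_S → 0` as `t + j → ∞` in `dom φ`. -/
def HybridArc.ConvergesTo {X : Type*} [PseudoMetricSpace X] (φ : HybridArc X) (S : Set X) : Prop :=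
  ∀ ε > 0, ∃ N : ℝ, ∀ (t : ℝ) (j : ℕ), (t, j) ∈ φ.dom → N ≤ t + j →
    Metric.infDist (φ.val t j) S < ε

/-- `ψ` is a proper extension of `φ`. -/
def HybridArc.ProperlyExtends {X : Type*} [PseudoMetricSpace X] (ψ φ : HybridArc X) : Prop :=
  φ.dom ⊂ ψ.dom ∧ ∀ (t : ℝ) (j : ℕ), (t, j) ∈ φ.dom → ψ.val t j = φ.val t j

namespace HybridSystem

variable {X : Type*} [NormedAddCommGroup X] [NormedSpace ℝ X]

/-- Solutions of a hybrid system. -/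
structure IsSolution (H : HybridSystem X) (φ : HybridArc X) : Prop where
  initial : φ.val 0 0 ∈ closure H.C ∪ H.D
  flow_mem : ∀ (j : ℕ), ∀ t ∈ interior (φ.interval j), φ.val t j ∈ H.C
  flow_deriv : ∀ (j : ℕ), ∀ᵐ t : ℝ, t ∈ interior (φ.interval j) →
    HasDerivAt (fun s => φ.val s j) (H.f (φ.val t j)) t
  jump : ∀ (t : ℝ) (j : ℕ), (t, j) ∈ φ.dom → (t, j + 1) ∈ φ.dom →
    φ.val t j ∈ H.D ∧ φ.val t (j + 1) ∈ H.G (φ.val t j)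

/-- Maximal solutions: those that are not the restriction of a solution with larger domain. -/
def IsMaximalSolution (H : HybridSystem X) (φ : HybridArc X) : Prop :=
  H.IsSolution φ ∧ ∀ ψ : HybridArc X, H.IsSolution ψ → ¬ ψ.ProperlyExtends φ

/-- Exponential stability of a set. -/
def ExponentiallyStable (H : HybridSystem X) (S : Set X) : Prop :=
  ∃ κ > 0, ∃ lam > 0, ∃ μ > 0, ∀ φ : HybridArc X, H.IsMaximalSolution φ →
    Metric.infDist (φ.val 0 0) S ≤ μ →
    φ.IsComplete ∧ ∀ (t : ℝ) (j : ℕ), (t, j) ∈ φ.dom →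
      Metric.infDist (φ.val t j) S ≤
        κ * Real.exp (-lam * (t + j)) * Metric.infDist (φ.val 0 0) S

/-- The basin of attraction of a set. -/
def basinOfAttraction (H : HybridSystem X) (S : Set X) : Set X :=
  {ξ | ∀ φ : HybridArc X, H.IsMaximalSolution φ → φ.val 0 0 = ξ →
    φ.IsComplete ∧ φ.ConvergesTo S}

end HybridSystem

/-! ### Saturation -/

/-- Decentralized symmetric saturation with levels `ubar`. -/
def satVec {m : ℕ} (ubar : Fin m → ℝ) (v : Fin m → ℝ) : Fin m → ℝ :=
  fun i => min |v i| (ubar i) * Real.sign (v i)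

/-- Decentralized deadzone `dz(v) = sat(v) - v`. -/
def dzVec {m : ℕ} (ubar : Fin m → ℝ) (v : Fin m → ℝ) : Fin m → ℝ :=
  satVec ubar v - v

/-! ### The closed loop

The plant state `x_p ∈ ℝⁿ` is split into `q` blocks of sizes `n 0, …, n (q - 1)`; its coordinates are
indexed by pairs (block, coordinate in the block). -/

/-- Coordinates of `ℝⁿ = ℝ^{n_1} × ⋯ × ℝ^{n_q}`. -/
abbrev BlockIndex {q : ℕ} (n : Fin q → ℕ) : Type := Σ i : Fin q, Fin (n i)

/-- The space `ℝ^{2n + q}` of states `x = ((x_p, η̃), τ)`, with the Euclidean norm. -/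
abbrev ClState {q : ℕ} (n : Fin q → ℕ) : Type :=
  EuclideanSpace ℝ ((BlockIndex n ⊕ BlockIndex n) ⊕ Fin q)

section ClosedLoop

variable {q m : ℕ} {n : Fin q → ℕ}

/-- The component `x̄ = (x_p, η̃)`. -/
def ClState.xbar (x : ClState n) : BlockIndex n ⊕ BlockIndex n → ℝ := fun a => x (Sum.inl a)

/-- The plant state `x_p`. -/
def ClState.xp (x : ClState n) : BlockIndex n → ℝ := fun a => x (Sum.inl (Sum.inl a))

/-- The error `η̃`. -/
def ClState.err (x : ClState n) : BlockIndex n → ℝ := fun a => x (Sum.inl (Sum.inr a))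

/-- The timers `τ`. -/
def ClState.timer (x : ClState n) : Fin q → ℝ := fun i => x (Sum.inr i)

/-- The state with components `x̄` and `τ`. -/
def ClState.mk (xbar : BlockIndex n ⊕ BlockIndex n → ℝ) (τ : Fin q → ℝ) : ClState n :=
  WithLp.toLp 2 (Sum.elim xbar τ)

/-- `𝒯 = ∏ᵢ [0, T₂⁽ⁱ⁾]`. -/
def timerSet (T₂ : Fin q → ℝ) : Set (Fin q → ℝ) :=
  {τ | ∀ i, τ i ∈ Set.Icc 0 (T₂ i)}

/-- `𝒟ᵢ = {τ ∈ 𝒯 | τᵢ = 0}`. -/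
def timerJumpSet (T₂ : Fin q → ℝ) (i : Fin q) : Set (Fin q → ℝ) :=
  {τ | τ ∈ timerSet T₂ ∧ τ i = 0}

/-- Resets of the `i`-th timer to an arbitrary point of `[T₁⁽ⁱ⁾, T₂⁽ⁱ⁾]`. -/
def timerReset (T₁ T₂ : Fin q → ℝ) (i : Fin q) (τ : Fin q → ℝ) : Set (Fin q → ℝ) :=
  {χ | χ i ∈ Set.Icc (T₁ i) (T₂ i) ∧ ∀ k, k ≠ i → χ k = τ k}

/-- `A_cl = [A + BK, -BK; 0, A]`. -/
def clA (A : Matrix (BlockIndex n) (BlockIndex n) ℝ) (B : Matrix (BlockIndex n) (Fin m) ℝ)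
    (K : Matrix (Fin m) (BlockIndex n) ℝ) :
    Matrix (BlockIndex n ⊕ BlockIndex n) (BlockIndex n ⊕ BlockIndex n) ℝ :=
  fromBlocks (A + B * K) (-(B * K)) 0 A

/-- `B_cl = [B; 0]`. -/
def clB (B : Matrix (BlockIndex n) (Fin m) ℝ) :
    Matrix (BlockIndex n ⊕ BlockIndex n) (Fin m) ℝ :=
  fromRows B 0

/-- `K_cl = [K, -K]`. -/
def clK (K : Matrix (Fin m) (BlockIndex n) ℝ) :
    Matrix (Fin m) (BlockIndex n ⊕ BlockIndex n) ℝ :=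
  fromCols K (-K)

/-- `h_i(η̃) = (⨁ⱼ H_j^{(i)}) η̃`: sets the `i`-th block of `η̃` to zero. -/
def errReset (i : Fin q) (e : BlockIndex n → ℝ) : BlockIndex n → ℝ :=
  blockDiagonal' (fun j : Fin q => if i = j then (0 : Matrix (Fin (n j)) (Fin (n j)) ℝ) else 1) *ᵥ e

/-- The closed-loop hybrid system. -/
def closedLoop (A : Matrix (BlockIndex n) (BlockIndex n) ℝ) (B : Matrix (BlockIndex n) (Fin m) ℝ)
    (ubar : Fin m → ℝ) (T₁ T₂ : Fin q → ℝ) (K : Matrix (Fin m) (BlockIndex n) ℝ) :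
    HybridSystem (ClState n) where
  f x := ClState.mk (clA A B K *ᵥ x.xbar + clB B *ᵥ dzVec ubar (clK K *ᵥ x.xbar)) (fun _ => -1)
  C := {x | x.timer ∈ timerSet T₂}
  G x := {g | g.xp = x.xp ∧ ∃ i : Fin q, x.timer ∈ timerJumpSet T₂ i ∧
    g.err = errReset i x.err ∧ g.timer ∈ timerReset T₁ T₂ i x.timer}
  D := {x | ∃ i : Fin q, x.timer ∈ timerJumpSet T₂ i}

/-- The set `𝒜 = {0} × 𝒯`. -/
def attractor (n : Fin q → ℕ) (T₂ : Fin q → ℝ) : Set (ClState n) :=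
  {x | x.xbar = 0 ∧ x.timer ∈ timerSet T₂}

/-! ### The matrix inequalities -/

/-- `He M = M + Mᵀ`. -/
def matHe {ι : Type*} (M : Matrix ι ι ℝ) : Matrix ι ι ℝ := M + Mᵀ

/-- `R(τ) = ⨁ⱼ e^{σⱼ τⱼ} Rⱼ`. -/
def clockR (R : ∀ i : Fin q, Matrix (Fin (n i)) (Fin (n i)) ℝ) (σ : Fin q → ℝ) (τ : Fin q → ℝ) :
    Matrix (BlockIndex n) (BlockIndex n) ℝ :=
  blockDiagonal' fun j => Real.exp (σ j * τ j) • R j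

/-- `Σ = ⨁ⱼ σⱼ I_{nⱼ}`. -/
def sigmaMat (n : Fin q → ℕ) (σ : Fin q → ℝ) : Matrix (BlockIndex n) (BlockIndex n) ℝ :=
  blockDiagonal' fun j => σ j • (1 : Matrix (Fin (n j)) (Fin (n j)) ℝ)

/-- `P̂(τ) = W⁻¹ ⊕ R(τ)`. -/
def clockP (W : Matrix (BlockIndex n) (BlockIndex n) ℝ)
    (R : ∀ i : Fin q, Matrix (Fin (n i)) (Fin (n i)) ℝ) (σ : Fin q → ℝ) (τ : Fin q → ℝ) :
    Matrix (BlockIndex n ⊕ BlockIndex n) (BlockIndex n ⊕ BlockIndex n) ℝ :=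
  fromBlocks W⁻¹ 0 0 (clockR R σ τ)

/-- The sublevel set `𝒬_μ̄ = {x = (x̄, τ) ∈ 𝒞 | x̄ᵀ P̂(τ) x̄ ≤ μ̄}`. -/
def sublevelQ (T₂ : Fin q → ℝ) (W : Matrix (BlockIndex n) (BlockIndex n) ℝ)
    (R : ∀ i : Fin q, Matrix (Fin (n i)) (Fin (n i)) ℝ) (σ : Fin q → ℝ) (μbar : ℝ) :
    Set (ClState n) :=
  {x | x.timer ∈ timerSet T₂ ∧ x.xbar ⬝ᵥ (clockP W R σ x.timer *ᵥ x.xbar) ≤ μbar}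

/-- The matrix `[W, 0, Z_(i)ᵀ; ⋆, ⨁ⱼ Rⱼ, J_(i)ᵀ; ⋆, ⋆, ūᵢ² / μ̄]`. -/
def inclusionLMI (ubar : Fin m → ℝ) (W : Matrix (BlockIndex n) (BlockIndex n) ℝ)
    (R : ∀ i : Fin q, Matrix (Fin (n i)) (Fin (n i)) ℝ) (Z J : Matrix (Fin m) (BlockIndex n) ℝ)
    (μbar : ℝ) (i : Fin m) :
    Matrix ((BlockIndex n ⊕ BlockIndex n) ⊕ Fin 1) ((BlockIndex n ⊕ BlockIndex n) ⊕ Fin 1) ℝ :=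
  fromBlocks
    (fromBlocks W 0 0 (blockDiagonal' R))
    (fromRows (replicateCol (Fin 1) (Z i)) (replicateCol (Fin 1) (J i)))
    (fromRows (replicateCol (Fin 1) (Z i)) (replicateCol (Fin 1) (J i)))ᵀ
    !![ubar i ^ 2 / μbar]

/-- The matrix `𝔐(τ)`, equal to
`[He((A+BK)W), -BK, BS - WKᵀ - Zᵀ; ⋆, He(R(τ)A) - ΣR(τ), Kᵀ - Jᵀ; ⋆, ⋆, -2S]`. -/
def clockM (A : Matrix (BlockIndex n) (BlockIndex n) ℝ) (B : Matrix (BlockIndex n) (Fin m) ℝ)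
    (K : Matrix (Fin m) (BlockIndex n) ℝ) (W : Matrix (BlockIndex n) (BlockIndex n) ℝ)
    (R : ∀ i : Fin q, Matrix (Fin (n i)) (Fin (n i)) ℝ) (S : Matrix (Fin m) (Fin m) ℝ)
    (σ : Fin q → ℝ) (Z J : Matrix (Fin m) (BlockIndex n) ℝ) (τ : Fin q → ℝ) :
    Matrix ((BlockIndex n ⊕ BlockIndex n) ⊕ Fin m) ((BlockIndex n ⊕ BlockIndex n) ⊕ Fin m) ℝ :=
  fromBlocks
    (fromBlocks
      (matHe ((A + B * K) * W)) (-(B * K))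
      (-(B * K))ᵀ (matHe (clockR R σ τ * A) - sigmaMat n σ * clockR R σ τ))
    (fromRows (B * S - W * Kᵀ - Zᵀ) (Kᵀ - Jᵀ))
    (fromRows (B * S - W * Kᵀ - Zᵀ) (Kᵀ - Jᵀ))ᵀ
    (-((2 : ℝ) • S))

end ClosedLoop

end

/-!
The Lyapunov function is `V(x) = x̄ᵀ (W⁻¹ ⊕ R(τ)) x̄`, comparable to the squared distance to the
attractor.

*Flows.*  In the coordinates `w = W⁻¹ x_p`, `e = η̃`, `ζ = S⁻¹ dz(u)` with `u = K (x_p - η̃)`, the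
derivative of `V` along flows equals the quadratic form of `𝔐(τ)` at `(w, e, ζ)` plus
`2 ζᵀ (sat(u) + Z w + J e)` (`quadForm_clockM`).  By the first matrix inequality `|Z w + J e| ≤ ū`
componentwise where `V ≤ μ̄` (`abs_le_ubar_of_inclusionLMI`), so the extra term is nonpositive by the
sector property of the deadzone (`dzVec_mul_le`).  As `𝔐(τ)` is negative definite, uniformly on the
compact set `𝒯`, this gives `V' ≤ -γ V` where `V ≤ μ̄` (`exists_lyapunovDeriv_le`), and then
`{V ≤ μ̄}` is forward invariant.

*Jumps.*  `V` does not increase, since the timer `τᵢ` enters `V` only through the block `η̃⁽ⁱ⁾`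
(`lyapunov_le_of_jump`).  The sum of the timers decreases at rate `q` along flows and grows by at
least `min T₁` at jumps, so `j` is at most affine in `t` (`mul_jumps_le`), and decay in `t` is decay
in `t + j` (`exists_infDist_le`).

*Completeness.*  The flow map is globally Lipschitz, so a solution with bounded domain can be
prolonged by flowing until a timer expires, and then by a jump (`isComplete_of_isMaximalSolution`).
Absolutely continuous solutions are classical because the flow map is continuous
(`HybridSystem.IsSolution.hasDerivWithinAt`).

A set satisfying `IsHybridTimeDomain` may branch: the interval with index `j` may continue beyond the
start of the interval with index `j + 1`.  For solutions of the closed loop this is excluded by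
`le_of_jump`.
-/

/-! ### Hybrid time domains -/

/-- The interval with index `j` of a hybrid time domain has a left end point `s`, which is `0` for
`j = 0` and lies in the interval with index `j - 1` otherwise. -/
theorem IsHybridTimeDomain.exists_start {E : Set (ℝ × ℕ)} (hE : IsHybridTimeDomain E) {t : ℝ}
    {j : ℕ} (h : (t, j) ∈ E) :
    ∃ s, s ≤ t ∧ (∀ r, (r, j) ∈ E → s ≤ r) ∧ (∀ r ∈ Set.Icc s t, (r, j) ∈ E) ∧
      (j = 0 → s = 0) ∧ ∀ k, j = k + 1 → (s, k) ∈ E := by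
  obtain ⟨N, τ, h0, hmono, hEq⟩ := hE.2.2 _ h
  have key : ∀ r k, ((r, k) ∈ E ∧ r ≤ t ∧ k ≤ j) ↔ k < N ∧ r ∈ Set.Icc (τ k) (τ (k + 1)) := by
    intro r k
    have := Set.ext_iff.1 hEq (r, k)
    simpa using this
  obtain ⟨hjN, hjt⟩ := (key t j).1 ⟨h, le_rfl, le_rfl⟩
  refine ⟨τ j, hjt.1, fun r hr => ?_, fun r hr => ?_, fun hj => by rw [hj, h0], ?_⟩
  · rcases le_or_gt r t with hrt | hrt
    · exact ((key r j).1 ⟨hr, hrt, le_rfl⟩).2.1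
    · exact hjt.1.trans hrt.le
  · exact ((key r j).2 ⟨hjN, hr.1, hr.2.trans hjt.2⟩).1
  · rintro k rfl
    exact ((key (τ (k + 1)) k).2 ⟨by omega, hmono (Nat.le_succ k), le_rfl⟩).1

theorem IsHybridTimeDomain.zero_mem {E : Set (ℝ × ℕ)} (hE : IsHybridTimeDomain E) :
    ((0 : ℝ), 0) ∈ E := by
  have key : ∀ j t, (t, j) ∈ E → ((0 : ℝ), 0) ∈ E := by
    intro j
    induction j with
    | zero =>
      intro t ht
      obtain ⟨s, hst, -, h, h0, -⟩ := hE.exists_start ht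
      rw [h0 rfl] at h hst
      exact h 0 ⟨le_rfl, hst⟩
    | succ k ih =>
      intro t ht
      obtain ⟨s, -, -, -, -, h⟩ := hE.exists_start ht
      exact ih s (h k rfl)
  obtain ⟨⟨t, j⟩, h⟩ := hE.1
  exact key j t h

theorem IsHybridTimeDomain.Icc_subset {E : Set (ℝ × ℕ)} (hE : IsHybridTimeDomain E) {a b : ℝ}
    {j : ℕ} (ha : (a, j) ∈ E) (hb : (b, j) ∈ E) : ∀ r ∈ Set.Icc a b, (r, j) ∈ E := by
  obtain ⟨s, -, hmin, h, -⟩ := hE.exists_start hb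
  exact fun r hr => h r ⟨(hmin a ha).trans hr.1, hr.2⟩

/-- Induction along a hybrid time domain: a property that holds at `(0, 0)` and is preserved by
flowing and by jumping holds on the whole domain. -/
theorem IsHybridTimeDomain.induction {E : Set (ℝ × ℕ)} (hE : IsHybridTimeDomain E)
    {P : ℝ → ℕ → Prop} (zero : P 0 0)
    (flow : ∀ j a b, a ≤ b → (∀ r ∈ Set.Icc a b, (r, j) ∈ E) → P a j → P b j)
    (jump : ∀ t j, (t, j) ∈ E → (t, j + 1) ∈ E → P t j → P t (j + 1)) :
    ∀ t j, (t, j) ∈ E → P t j := by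
  intro t j
  induction j generalizing t with
  | zero =>
    intro ht
    obtain ⟨s, hst, -, h, h0, -⟩ := hE.exists_start ht
    rw [h0 rfl] at h hst
    exact flow 0 0 t hst h zero
  | succ k ih =>
    intro ht
    obtain ⟨s, hst, -, h, -, hs⟩ := hE.exists_start ht
    exact flow _ s t hst h (jump s k (hs k rfl) (h s ⟨le_rfl, hst⟩) (ih s (hs k rfl)))

/-- The last interval of a hybrid time domain can be prolonged to the right.  The hypothesis `hle`
is not automatic: a set with the properties required of a hybrid time domain may continue an
interval beyond the time at which the next one starts. -/
theorem IsHybridTimeDomain.union_flow {E : Set (ℝ × ℕ)} (hE : IsHybridTimeDomain E) {s T : ℝ}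
    {J : ℕ} (hs : (s, J) ∈ E) (hmin : ∀ r, (r, J) ∈ E → s ≤ r) (hJ : ∀ p ∈ E, p.2 ≤ J)
    (hle : ∀ p ∈ E, p.2 < J → p.1 ≤ s) (hT : ∀ r, (r, J) ∈ E → r ≤ T) :
    IsHybridTimeDomain (E ∪ {p | p.2 = J ∧ p.1 ∈ Set.Icc s T}) := by
  have hs0 : 0 ≤ s := hE.2.1 _ hs
  refine ⟨hE.1.mono Set.subset_union_left, ?_, ?_⟩
  · rintro p (hp | hp)
    · exact hE.2.1 p hp
    · exact hs0.trans hp.2.1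
  intro p hp
  by_cases hpJ : p.2 = J
  · have hpI : p.1 ∈ Set.Icc s T := by
      rcases hp with hp | hp
      · rw [← Prod.mk.eta (p := p), hpJ] at hp
        exact ⟨hmin _ hp, hT _ hp⟩
      · exact hp.2
    obtain ⟨N, τ, h0, hmono, hEq⟩ := hE.2.2 _ hs
    have key : ∀ r k, ((r, k) ∈ E ∧ r ≤ s ∧ k ≤ J) ↔
        k < N ∧ r ∈ Set.Icc (τ k) (τ (k + 1)) := by
      intro r k
      have := Set.ext_iff.1 hEq (r, k)
      simpa using this
    obtain ⟨hJN, hJs⟩ := (key s J).1 ⟨hs, le_rfl, le_rfl⟩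
    have hτJ : τ J = s :=
      le_antisymm hJs.1 (hmin _ ((key (τ J) J).2 ⟨hJN, le_rfl, hmono (Nat.le_succ J)⟩).1)
    refine ⟨J + 1, fun k => if k ≤ J then τ k else p.1, by simp [h0], ?_, ?_⟩
    · refine monotone_nat_of_le_succ fun k => ?_
      rcases lt_trichotomy k J with hk | rfl | hk
      · simp [hk.le, Nat.succ_le_of_lt hk, hmono (Nat.le_succ k)]
      · simp [hτJ, hpI.1]
      · simp [not_le.2 hk, show ¬ (k + 1 ≤ J) by omega]
    · ext ⟨r, k⟩
      rcases lt_trichotomy k J with hk | rfl | hk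
      · have h1 : k + 1 ≤ J := hk
        simp only [Set.mem_inter_iff, Set.mem_union, Set.mem_ofPred_eq, hk.ne, false_and, or_false,
          hk.le, h1, if_true]
        constructor
        · rintro ⟨hrE, -⟩
          exact ⟨by omega, ((key r k).1 ⟨hrE, hle _ hrE hk, hk.le⟩).2⟩
        · rintro ⟨-, hr⟩
          obtain ⟨hrE, hrs, -⟩ := (key r k).2 ⟨by omega, hr⟩
          exact ⟨hrE, hrs.trans hpI.1, by omega⟩
      · simp only [Set.mem_inter_iff, Set.mem_union, Set.mem_ofPred_eq, hpJ, le_refl, true_and,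
          and_true, if_true, show ¬ (k + 1 ≤ k) by omega, if_false, hτJ, lt_add_iff_pos_right,
          zero_lt_one]
        constructor
        · rintro ⟨hr | hr, hrp⟩
          · exact ⟨hmin _ hr, hrp⟩
          · exact ⟨hr.1, hrp⟩
        · rintro ⟨h1, h2⟩
          exact ⟨Or.inr ⟨h1, h2.trans hpI.2⟩, h2⟩
      · simp only [Set.mem_inter_iff, Set.mem_ofPred_eq, hpJ]
        constructor
        · rintro ⟨-, -, h⟩
          omega
        · rintro ⟨h, -⟩
          omega
  · have hpE : p ∈ E := hp.resolve_right fun h => hpJ h.1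
    convert hE.2.2 p hpE using 1
    have := hJ p hpE
    ext ⟨r, k⟩
    simp only [Set.mem_inter_iff, Set.mem_union, Set.mem_ofPred_eq]
    constructor
    · rintro ⟨h | h, h'⟩
      · exact ⟨h, h'⟩
      · omega
    · rintro ⟨h, h'⟩
      exact ⟨Or.inl h, h'⟩

/-- A hybrid time domain can be prolonged by a jump from a point of its last interval. -/
theorem IsHybridTimeDomain.union_jump {E : Set (ℝ × ℕ)} (hE : IsHybridTimeDomain E) {T : ℝ}
    {J : ℕ} (hT : (T, J) ∈ E) (hJ : ∀ p ∈ E, p.2 ≤ J) :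
    IsHybridTimeDomain (E ∪ {(T, J + 1)}) := by
  refine ⟨hE.1.mono Set.subset_union_left, ?_, ?_⟩
  · rintro p (hp | rfl)
    · exact hE.2.1 p hp
    · exact hE.2.1 (T, J) hT
  rintro p (hp | rfl)
  · convert hE.2.2 p hp using 1
    have := hJ p hp
    ext ⟨r, k⟩
    simp only [Set.mem_inter_iff, Set.mem_union, Set.mem_ofPred_eq, Set.mem_singleton_iff,
      Prod.mk.injEq]
    constructor
    · rintro ⟨h | h, h'⟩
      · exact ⟨h, h'⟩
      · omega
    · rintro ⟨h, h'⟩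
      exact ⟨Or.inl h, h'⟩
  · obtain ⟨N, τ, h0, hmono, hEq⟩ := hE.2.2 _ hT
    have key : ∀ r k, ((r, k) ∈ E ∧ r ≤ T ∧ k ≤ J) ↔
        k < N ∧ r ∈ Set.Icc (τ k) (τ (k + 1)) := by
      intro r k
      have := Set.ext_iff.1 hEq (r, k)
      simpa using this
    obtain ⟨hJN, hJs⟩ := (key T J).1 ⟨hT, le_rfl, le_rfl⟩
    have hτ : τ (J + 1) = T :=
      le_antisymm ((key (τ (J + 1)) J).2 ⟨hJN, hmono (Nat.le_succ J), le_rfl⟩).2.1 hJs.2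
    refine ⟨J + 2, fun k => if k ≤ J + 1 then τ k else T, by simp [h0], ?_, ?_⟩
    · refine monotone_nat_of_le_succ fun k => ?_
      rcases lt_trichotomy k (J + 1) with hk | rfl | hk
      · simp [hk.le, show k ≤ J by omega, hmono (Nat.le_succ k)]
      · simp [hτ]
      · simp [not_le.2 hk, show ¬ (k ≤ J) by omega]
    · ext ⟨r, k⟩
      rcases lt_trichotomy k (J + 1) with hk | rfl | hk
      · have h1 : k ≤ J := by omega
        have h2 : k + 1 ≤ J + 1 := by omega
        simp only [Set.mem_inter_iff, Set.mem_union, Set.mem_ofPred_eq, Set.mem_singleton_iff,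
          Prod.mk.injEq, hk.ne, and_false, or_false, hk.le, h2, if_true, and_true]
        constructor
        · rintro ⟨hrE, hrT⟩
          exact ⟨by omega, ((key r k).1 ⟨hrE, hrT, h1⟩).2⟩
        · rintro ⟨-, hr⟩
          obtain ⟨hrE, hrT, -⟩ := (key r k).2 ⟨by omega, hr⟩
          exact ⟨hrE, hrT⟩
      · simp only [Set.mem_inter_iff, Set.mem_union, Set.mem_ofPred_eq, Set.mem_singleton_iff,
          Prod.mk.injEq, and_true, le_refl, if_true, show ¬ (J + 1 + 1 ≤ J + 1) by omega, if_false,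
          hτ, show J + 1 < J + 2 by omega, true_and, Set.Icc_self]
        constructor
        · rintro ⟨hr | hr, -⟩
          · have := hJ _ hr
            simp at this
          · exact hr
        · rintro rfl
          exact ⟨Or.inr rfl, le_rfl⟩
      · simp only [Set.mem_inter_iff, Set.mem_ofPred_eq]
        constructor
        · rintro ⟨-, -, h⟩
          omega
        · rintro ⟨h, -⟩
          omega

/-- If the intervals of a hybrid time domain never reach beyond the start of their successor, then
all intervals but the last end where the last starts, or before. -/
theorem IsHybridTimeDomain.le_of_lt {E : Set (ℝ × ℕ)} (hE : IsHybridTimeDomain E)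
    (hnb : ∀ t r j, (t, j) ∈ E → (t, j + 1) ∈ E → (r, j) ∈ E → r ≤ t) {s : ℝ} {J : ℕ}
    (hs : (s, J) ∈ E) {r : ℝ} {k : ℕ} (hr : (r, k) ∈ E) (hk : k < J) : r ≤ s := by
  induction J generalizing s with
  | zero => omega
  | succ J ih =>
    obtain ⟨u, hus, -, h, -, hu⟩ := hE.exists_start hs
    have huJ := hu J rfl
    refine le_trans ?_ hus
    rcases Nat.lt_succ_iff_lt_or_eq.1 hk with hk | rfl
    · exact ih huJ hk
    · exact hnb u r k huJ (h u ⟨le_rfl, hus⟩) hr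

/-! ### Solutions of a differential equation with a Lipschitz right-hand side -/

section ODE

variable {X : Type*} [NormedAddCommGroup X] [NormedSpace ℝ X]

/-- Concatenation of two solutions of `y' = f y`. -/
theorem exists_hasDerivWithinAt_Icc_trans {f : X → X} {a b c : ℝ} (hab : a ≤ b) (hbc : b ≤ c)
    {y z : ℝ → X} (hy : ∀ t ∈ Set.Icc a b, HasDerivWithinAt y (f (y t)) (Set.Icc a b) t)
    (hz : ∀ t ∈ Set.Icc b c, HasDerivWithinAt z (f (z t)) (Set.Icc b c) t) (h : z b = y b) :
    ∃ w : ℝ → X, w a = y a ∧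
      ∀ t ∈ Set.Icc a c, HasDerivWithinAt w (f (w t)) (Set.Icc a c) t := by
  have hwy : ∀ t, t ≤ b → (if t ≤ b then y t else z t) = y t := fun t ht => if_pos ht
  have hwz : ∀ t, b ≤ t → (if t ≤ b then y t else z t) = z t := by
    intro t ht
    rcases ht.eq_or_lt with rfl | ht
    · simp [h]
    · simp [not_le.2 ht]
  refine ⟨fun t => if t ≤ b then y t else z t, hwy a hab, fun t ht => ?_⟩
  have h1 : t ≤ b → HasDerivWithinAt (fun t => if t ≤ b then y t else z t) (f (y t))
      (Set.Icc a b) t := fun htb =>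
    (hy t ⟨ht.1, htb⟩).congr (fun r hr => hwy r hr.2) (hwy t htb)
  have h2 : b ≤ t → HasDerivWithinAt (fun t => if t ≤ b then y t else z t) (f (z t))
      (Set.Icc b c) t := fun htb =>
    (hz t ⟨htb, ht.2⟩).congr (fun r hr => hwz r hr.1) (hwz t htb)
  rcases lt_trichotomy t b with htb | rfl | htb
  · simp only [if_pos htb.le]
    refine (h1 htb.le).mono_of_mem_nhdsWithin ?_
    filter_upwards [self_mem_nhdsWithin, nhdsWithin_le_nhds (Iio_mem_nhds htb)] with r hr hrb
    exact ⟨hr.1, (Set.mem_Iio.1 hrb).le⟩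
  · have := h2 le_rfl
    rw [h] at this
    simp only [le_refl, if_true]
    rw [← Set.Icc_union_Icc_eq_Icc hab hbc]
    exact (h1 le_rfl).union this
  · simp only [if_neg (not_le.2 htb)]
    refine (h2 htb.le).mono_of_mem_nhdsWithin ?_
    filter_upwards [self_mem_nhdsWithin, nhdsWithin_le_nhds (Ioi_mem_nhds htb)] with r hr hrb
    exact ⟨(Set.mem_Ioi.1 hrb).le, hr.2⟩

/-- A differential equation with a globally Lipschitz right-hand side has solutions on compact
intervals of any length, for any initial value. -/
theorem LipschitzWith.exists_hasDerivWithinAt_Icc [CompleteSpace X] {f : X → X} {K : NNReal}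
    (hf : LipschitzWith K f) (s T : ℝ) (x : X) :
    ∃ y : ℝ → X, y s = x ∧
      ∀ t ∈ Set.Icc s T, HasDerivWithinAt y (f (y t)) (Set.Icc s T) t := by
  -- Picard-Lindelöf gives solutions on an interval whose length does not depend on `x`
  set h : ℝ := (2 * (K + 1))⁻¹ with hh
  have hh0 : 0 < h := by positivity
  have local_sol : ∀ (s : ℝ) (x : X), ∃ y : ℝ → X, y s = x ∧
      ∀ t ∈ Set.Icc s (s + h), HasDerivWithinAt y (f (y t)) (Set.Icc s (s + h)) t := by
    intro s x
    have hp : IsPicardLindelof (fun _ => f) (tmin := s) (tmax := s + h)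
        ⟨s, le_rfl, by linarith⟩ x (‖f x‖₊ / (K + 1)) 0 (2 * ‖f x‖₊) K := by
      refine IsPicardLindelof.of_time_independent ?_ hf.lipschitzOnWith ?_
      · intro z hz
        have h1 := hf.dist_le_mul z x
        have h2 : dist z x ≤ ‖f x‖ / (K + 1) := by simpa using hz
        have h3 : ‖f z‖ ≤ ‖f x‖ + dist (f z) (f x) := by
          rw [dist_eq_norm]
          exact norm_le_norm_add_norm_sub' _ _
        have h4 : (K : ℝ) * dist z x ≤ ‖f x‖ := by
          calc (K : ℝ) * dist z x ≤ (K + 1) * (‖f x‖ / (K + 1)) := by gcongr; linarith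
            _ = ‖f x‖ := by field_simp
        push_cast
        linarith
      · simp only [add_sub_cancel_left, sub_self, max_eq_left hh0.le]
        push_cast
        rw [sub_zero, hh]
        refine le_of_eq ?_
        field_simp
    obtain ⟨y, h1, h2⟩ := hp.exists_eq_forall_mem_Icc_hasDerivWithinAt₀
    exact ⟨y, h1, h2⟩
  have steps : ∀ N : ℕ, ∃ y : ℝ → X, y s = x ∧ ∀ t ∈ Set.Icc s (s + N * h),
      HasDerivWithinAt y (f (y t)) (Set.Icc s (s + N * h)) t := by
    intro N
    induction N with
    | zero =>
      obtain ⟨y, h1, h2⟩ := local_sol s x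
      have hsub : Set.Icc s (s + (0 : ℕ) * h) ⊆ Set.Icc s (s + h) :=
        Set.Icc_subset_Icc_right (by simp [hh0.le])
      exact ⟨y, h1, fun t ht => (h2 t (hsub ht)).mono hsub⟩
    | succ N ih =>
      obtain ⟨y, h1, h2⟩ := ih
      obtain ⟨z, h3, h4⟩ := local_sol (s + N * h) (y (s + N * h))
      have hN : 0 ≤ (N : ℝ) * h := by positivity
      obtain ⟨w, h5, h6⟩ := exists_hasDerivWithinAt_Icc_trans (by linarith) (by linarith) h2 h4 h3
      have : s + ((N + 1 : ℕ) : ℝ) * h = s + N * h + h := by push_cast; ring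
      exact ⟨w, h5.trans h1, this ▸ h6⟩
  obtain ⟨N, hN⟩ := exists_nat_ge ((T - s) / h)
  rw [div_le_iff₀ hh0] at hN
  obtain ⟨y, h1, h2⟩ := steps N
  have hsub : Set.Icc s T ⊆ Set.Icc s (s + N * h) := Set.Icc_subset_Icc_right (by linarith)
  exact ⟨y, h1, fun t ht => (h2 t (hsub ht)).mono hsub⟩

theorem LipschitzWith.eqOn_of_hasDerivWithinAt_Icc {f : X → X} {K : NNReal}
    (hf : LipschitzWith K f) {a b : ℝ} {y z : ℝ → X}
    (hy : ∀ t ∈ Set.Icc a b, HasDerivWithinAt y (f (y t)) (Set.Icc a b) t)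
    (hz : ∀ t ∈ Set.Icc a b, HasDerivWithinAt z (f (z t)) (Set.Icc a b) t) (h : y a = z a) :
    Set.EqOn y z (Set.Icc a b) := by
  have hmem : ∀ t ∈ Set.Ico a b, Set.Icc a b ∈ nhdsWithin t (Set.Ici t) := by
    intro t ht
    filter_upwards [self_mem_nhdsWithin, nhdsWithin_le_nhds (Iio_mem_nhds ht.2)] with r hr hrb
    exact ⟨ht.1.trans hr, (Set.mem_Iio.1 hrb).le⟩
  exact ODE_solution_unique (v := fun _ => f) (fun _ => hf)
    (fun t ht => (hy t ht).continuousWithinAt)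
    (fun t ht => (hy t (Set.Ico_subset_Icc_self ht)).mono_of_mem_nhdsWithin (hmem t ht))
    (fun t ht => (hz t ht).continuousWithinAt)
    (fun t ht => (hz t (Set.Ico_subset_Icc_self ht)).mono_of_mem_nhdsWithin (hmem t ht)) h

theorem absolutelyContinuousOnInterval_of_hasDerivWithinAt {f : X → X} (hf : Continuous f)
    {a b : ℝ} (hab : a ≤ b) {y : ℝ → X}
    (hy : ∀ t ∈ Set.Icc a b, HasDerivWithinAt y (f (y t)) (Set.Icc a b) t) :
    AbsolutelyContinuousOnInterval y a b := by
  have hc : ContinuousOn (fun t => f (y t)) (Set.Icc a b) :=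
    hf.comp_continuousOn fun t ht => (hy t ht).continuousWithinAt
  obtain ⟨C, hC⟩ := isCompact_Icc.exists_bound_of_continuousOn hc
  have : LipschitzOnWith C.toNNReal y (Set.Icc a b) := by
    refine (convex_Icc a b).lipschitzOnWith_of_nnnorm_hasDerivWithin_le hy fun t ht => ?_
    rw [← NNReal.coe_le_coe, coe_nnnorm]
    exact (hC t ht).trans (Real.le_coe_toNNReal C)
  rw [← Set.uIcc_of_le hab] at this
  exact this.absolutelyContinuousOnInterval

end ODE

/-! ### Flows and extensions of solutions of hybrid systems -/

namespace HybridArc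

variable {X : Type*} [NormedAddCommGroup X]

theorem Ioo_subset_interior_interval {φ : HybridArc X} {a b : ℝ} {j : ℕ}
    (hab : ∀ t ∈ Set.Icc a b, (t, j) ∈ φ.dom) : Set.Ioo a b ⊆ interior (φ.interval j) :=
  interior_maximal (fun t ht => hab t (Set.Ioo_subset_Icc_self ht)) isOpen_Ioo

theorem continuousOn_val {φ : HybridArc X} {a b : ℝ} {j : ℕ}
    (hab : ∀ t ∈ Set.Icc a b, (t, j) ∈ φ.dom) :
    ContinuousOn (fun t => φ.val t j) (Set.Icc a b) := by
  rcases le_or_gt a b with h | h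
  · have := (φ.locallyAbsolutelyContinuous j a b h hab).continuousOn
    rwa [Set.uIcc_of_le h] at this
  · simp [Set.Icc_eq_empty_of_lt h]

end HybridArc

namespace HybridSystem

variable {X : Type*} [NormedAddCommGroup X] [NormedSpace ℝ X] {H : HybridSystem X}

/-- For a continuous flow map, the flowing parts of a solution are classical solutions of the
differential equation, not just absolutely continuous ones. -/
theorem IsSolution.hasDerivWithinAt [CompleteSpace X] (hf : Continuous H.f) {φ : HybridArc X}
    (hφ : H.IsSolution φ) {a b : ℝ} {j : ℕ} (hab : ∀ t ∈ Set.Icc a b, (t, j) ∈ φ.dom) :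
    ∀ t ∈ Set.Icc a b,
      HasDerivWithinAt (fun r => φ.val r j) (H.f (φ.val t j)) (Set.Icc a b) t := by
  intro t ht
  have hle : a ≤ b := ht.1.trans ht.2
  have hc := HybridArc.continuousOn_val hab
  set p := ODE.picard (fun _ => H.f) a (φ.val a j) (fun r => φ.val r j) with hp
  have hpd : ∀ t ∈ Set.Icc a b, HasDerivWithinAt p (H.f (φ.val t j)) (Set.Icc a b) t := by
    intro t ht
    exact ODE.hasDerivWithinAt_picard_Icc (f := fun _ => H.f) (u := Set.univ) ⟨le_rfl, hle⟩
      (hf.comp continuous_snd).continuousOn hc (fun _ _ => trivial) _ ht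
  have hpac : AbsolutelyContinuousOnInterval p a b := by
    obtain ⟨C, hC⟩ := isCompact_Icc.exists_bound_of_continuousOn (hf.comp_continuousOn hc)
    have : LipschitzOnWith C.toNNReal p (Set.Icc a b) := by
      refine (convex_Icc a b).lipschitzOnWith_of_nnnorm_hasDerivWithin_le hpd fun t ht => ?_
      rw [← NNReal.coe_le_coe, coe_nnnorm]
      exact (hC t ht).trans (Real.le_coe_toNNReal C)
    rw [← Set.uIcc_of_le hle] at this
    exact this.absolutelyContinuousOnInterval
  -- `φ - p` is absolutely continuous with derivative zero almost everywhere
  have hdiff := (φ.locallyAbsolutelyContinuous j a b hle hab).sub hpac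
  have hne : ∀ c : ℝ, ∀ᵐ x : ℝ, x ≠ c := fun c => by
    simp [MeasureTheory.ae_iff]
  obtain ⟨C, hC⟩ := hdiff.const_of_ae_hasDerivAt_zero (by
    filter_upwards [hφ.flow_deriv j, hne a, hne b] with x hx hxa hxb hxI
    rw [Set.uIcc_of_le hle] at hxI
    have hxo : x ∈ Set.Ioo a b :=
      ⟨lt_of_le_of_ne hxI.1 (Ne.symm hxa), lt_of_le_of_ne hxI.2 hxb⟩
    have h1 := hx (HybridArc.Ioo_subset_interior_interval hab hxo)
    have h2 := (hpd x hxI).hasDerivAt (Icc_mem_nhds hxo.1 hxo.2)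
    simpa using h1.sub h2)
  rw [Set.uIcc_of_le hle] at hC
  have hC0 : C = 0 := by
    rw [← hC a ⟨le_rfl, hle⟩]
    simp [hp, ODE.picard_apply]
  have heq : ∀ r ∈ Set.Icc a b, φ.val r j = p r := fun r hr => by
    have := hC r hr
    rw [hC0] at this
    exact sub_eq_zero.1 this
  exact (hpd t ht).congr heq (heq t ht)

/-- With a closed flow set, solutions stay in it up to the end points of the flowing intervals. -/
theorem IsSolution.mem_C_of_lt (hC : IsClosed H.C) {φ : HybridArc X} (hφ : H.IsSolution φ)
    {a b : ℝ} {j : ℕ} (hlt : a < b) (hab : ∀ t ∈ Set.Icc a b, (t, j) ∈ φ.dom) :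
    ∀ t ∈ Set.Icc a b, φ.val t j ∈ H.C := by
  have hc := HybridArc.continuousOn_val hab
  intro t ht
  rw [← closure_Ioo hlt.ne] at ht hc
  have hmap : Set.MapsTo (fun t => φ.val t j) (Set.Ioo a b) H.C := fun r hr =>
    hφ.flow_mem j r (HybridArc.Ioo_subset_interior_interval hab hr)
  exact hC.closure_subset ((hc t ht).mono subset_closure |>.mem_closure ht hmap)

theorem IsMaximalSolution.not_agree_on_larger {φ ψ : HybridArc X} (hφ : H.IsMaximalSolution φ)
    (hψ : H.IsSolution ψ) (hsub : φ.dom ⊆ ψ.dom)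
    (h : ∀ t j, (t, j) ∈ φ.dom → ψ.val t j = φ.val t j) : ψ.dom ⊆ φ.dom := by
  by_contra hn
  exact hφ.2 ψ hψ ⟨⟨hsub, hn⟩, h⟩

/-- The last interval of a maximal solution reaches as far as the differential equation can be
solved within the flow set. -/
theorem IsMaximalSolution.mem_dom_of_flow [CompleteSpace X] {K : NNReal}
    (hf : LipschitzWith K H.f) {φ : HybridArc X} (hφ : H.IsMaximalSolution φ) {s T : ℝ} {J : ℕ}
    (hs : (s, J) ∈ φ.dom) (hmin : ∀ r, (r, J) ∈ φ.dom → s ≤ r) (hJ : ∀ p ∈ φ.dom, p.2 ≤ J)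
    (hle : ∀ p ∈ φ.dom, p.2 < J → p.1 ≤ s) (hT : ∀ r, (r, J) ∈ φ.dom → r ≤ T) {y : ℝ → X}
    (hys : y s = φ.val s J)
    (hy : ∀ t ∈ Set.Icc s T, HasDerivWithinAt y (H.f (y t)) (Set.Icc s T) t)
    (hyC : ∀ t ∈ Set.Icc s T, y t ∈ H.C) : (T, J) ∈ φ.dom := by
  have hsT : s ≤ T := hT s hs
  have hdom := φ.isHybridTimeDomain
  have heq : ∀ t, (t, J) ∈ φ.dom → y t = φ.val t J := by
    intro t ht
    have hsub : Set.Icc s t ⊆ Set.Icc s T := Set.Icc_subset_Icc_right (hT t ht)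
    exact hf.eqOn_of_hasDerivWithinAt_Icc (fun r hr => (hy r (hsub hr)).mono hsub)
      (hφ.1.hasDerivWithinAt hf.continuous (hdom.Icc_subset hs ht)) hys ⟨hmin t ht, le_rfl⟩
  have hmemJ : ∀ t, (t, J) ∈ φ.dom ∪ {p | p.2 = J ∧ p.1 ∈ Set.Icc s T} ↔ t ∈ Set.Icc s T := by
    intro t
    constructor
    · rintro (h | h)
      · exact ⟨hmin t h, hT t h⟩
      · exact h.2
    · exact fun h => Or.inr ⟨rfl, h⟩
  have hmem : ∀ t j, j ≠ J →
      ((t, j) ∈ φ.dom ∪ {p | p.2 = J ∧ p.1 ∈ Set.Icc s T} ↔ (t, j) ∈ φ.dom) := by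
    intro t j hj
    simp [hj]
  let ψ : HybridArc X :=
    { dom := φ.dom ∪ {p | p.2 = J ∧ p.1 ∈ Set.Icc s T}
      val := fun t j => if j = J then y t else φ.val t j
      isHybridTimeDomain := hdom.union_flow hs hmin hJ hle hT
      locallyAbsolutelyContinuous := by
        intro j a b hab h
        by_cases hj : j = J
        · subst hj
          simp only [if_true]
          have hsub : Set.Icc a b ⊆ Set.Icc s T := fun t ht => (hmemJ t).1 (h t ht)
          exact absolutelyContinuousOnInterval_of_hasDerivWithinAt hf.continuous hab
            fun t ht => (hy t (hsub ht)).mono hsub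
        · simp only [if_neg hj]
          exact φ.locallyAbsolutelyContinuous j a b hab fun t ht => (hmem t j hj).1 (h t ht) }
  have hψJ : ψ.interval J = Set.Icc s T := Set.ext hmemJ
  have hψj : ∀ j, j ≠ J → ψ.interval j = φ.interval j := fun j hj =>
    Set.ext fun t => hmem t j hj
  have hval : ∀ t j, (t, j) ∈ φ.dom → ψ.val t j = φ.val t j := by
    intro t j h
    by_cases hj : j = J
    · subst hj
      simpa [ψ] using heq t h
    · simp [ψ, hj]
  have hψ : H.IsSolution ψ := by
    refine ⟨?_, ?_, ?_, ?_⟩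
    · rw [hval 0 0 hdom.zero_mem]
      exact hφ.1.initial
    · intro j t ht
      by_cases hj : j = J
      · subst hj
        rw [hψJ] at ht
        simpa [ψ] using hyC t (interior_subset ht)
      · rw [hψj j hj] at ht
        simpa [ψ, hj] using hφ.1.flow_mem j t ht
    · intro j
      by_cases hj : j = J
      · subst hj
        refine Filter.Eventually.of_forall fun t ht => ?_
        rw [hψJ] at ht
        simpa [ψ] using (hy t (interior_subset ht)).hasDerivAt (mem_interior_iff_mem_nhds.1 ht)
      · rw [hψj j hj]
        simpa [ψ, hj] using hφ.1.flow_deriv j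
    · intro t j h1 h2
      have hjJ : j < J := by
        by_contra hn
        have hj : j + 1 ≠ J := by omega
        have := hJ _ ((hmem t (j + 1) hj).1 h2)
        simp at this
        omega
      have h1' := (hmem t j hjJ.ne).1 h1
      have h2' : (t, j + 1) ∈ φ.dom := by
        by_cases hj : j + 1 = J
        · have hts : t = s :=
            le_antisymm (hle _ h1' hjJ) ((hmemJ t).1 (by rw [hj] at h2; exact h2)).1
          rw [hts, hj]
          exact hs
        · exact (hmem t (j + 1) hj).1 h2
      rw [hval _ _ h1', hval _ _ h2']
      exact hφ.1.jump t j h1' h2'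
  exact hφ.not_agree_on_larger hψ Set.subset_union_left hval (Or.inr ⟨rfl, hsT, le_rfl⟩)

/-- A maximal solution does not end at a point from which a jump is possible. -/
theorem IsMaximalSolution.not_mem_D_of_last {φ : HybridArc X} (hφ : H.IsMaximalSolution φ)
    {T : ℝ} {J : ℕ} (hT : (T, J) ∈ φ.dom) (hJ : ∀ p ∈ φ.dom, p.2 ≤ J) {g : X}
    (hg : g ∈ H.G (φ.val T J)) : φ.val T J ∉ H.D := by
  intro hD
  have hdom := φ.isHybridTimeDomain
  have hlt : ∀ t j, (t, j) ∈ φ.dom → j ≠ J + 1 := by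
    rintro t j h rfl
    have := hJ _ h
    simp at this
  have hmemJ : ∀ t, (t, J + 1) ∈ φ.dom ∪ {(T, J + 1)} ↔ t = T := by
    intro t
    constructor
    · rintro (h | h)
      · exact absurd rfl (hlt _ _ h)
      · simpa using h
    · rintro rfl
      exact Or.inr rfl
  have hmem : ∀ t j, j ≠ J + 1 → ((t, j) ∈ φ.dom ∪ {(T, J + 1)} ↔ (t, j) ∈ φ.dom) := by
    intro t j hj
    simp [hj]
  let ψ : HybridArc X :=
    { dom := φ.dom ∪ {(T, J + 1)}
      val := fun t j => if j = J + 1 then g else φ.val t j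
      isHybridTimeDomain := hdom.union_jump hT hJ
      locallyAbsolutelyContinuous := by
        intro j a b hab h
        by_cases hj : j = J + 1
        · simp only [if_pos hj]
          exact (LipschitzWith.const g).lipschitzOnWith.absolutelyContinuousOnInterval
        · simp only [if_neg hj]
          exact φ.locallyAbsolutelyContinuous j a b hab fun t ht => (hmem t j hj).1 (h t ht) }
  have hψJ : interior (ψ.interval (J + 1)) = ∅ := by
    have : ψ.interval (J + 1) = {T} := Set.ext hmemJ
    rw [this, interior_singleton]
  have hψj : ∀ j, j ≠ J + 1 → ψ.interval j = φ.interval j := fun j hj =>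
    Set.ext fun t => hmem t j hj
  have hval : ∀ t j, (t, j) ∈ φ.dom → ψ.val t j = φ.val t j := by
    intro t j h
    simp [ψ, hlt t j h]
  have hψ : H.IsSolution ψ := by
    refine ⟨?_, ?_, ?_, ?_⟩
    · rw [hval 0 0 hdom.zero_mem]
      exact hφ.1.initial
    · intro j t ht
      by_cases hj : j = J + 1
      · subst hj
        simp [hψJ] at ht
      · rw [hψj j hj] at ht
        simpa [ψ, hj] using hφ.1.flow_mem j t ht
    · intro j
      by_cases hj : j = J + 1
      · subst hj
        simp [hψJ]
      · rw [hψj j hj]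
        simpa [ψ, hj] using hφ.1.flow_deriv j
    · intro t j h1 h2
      have hj : j ≠ J + 1 := by
        rintro rfl
        have := hJ _ ((hmem t (J + 1 + 1) (by omega)).1 h2)
        simp at this
      have h1' := (hmem t j hj).1 h1
      by_cases hjJ : j = J
      · subst hjJ
        have htT := (hmemJ t).1 h2
        subst htT
        simp only [ψ, hj, if_false, if_true]
        exact ⟨hD, hg⟩
      · have h2' := (hmem t (j + 1) (by omega)).1 h2
        rw [hval _ _ h1', hval _ _ h2']
        exact hφ.1.jump t j h1' h2'
  exact hlt _ _ (hφ.not_agree_on_larger hψ Set.subset_union_left hval (Or.inr rfl)) rfl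

end HybridSystem

/-! ### The flow map, the timers and the distance to the attractor -/

section ClosedLoop

variable {q m : ℕ} {n : Fin q → ℕ}

theorem satVec_apply_eq_max_min {ubar : Fin m → ℝ} (hubar : ∀ i, 0 < ubar i) (v : Fin m → ℝ)
    (i : Fin m) : satVec ubar v i = max (-ubar i) (min (v i) (ubar i)) := by
  have hu := hubar i
  unfold satVec
  rcases lt_trichotomy (v i) 0 with h | h | h
  · rw [Real.sign_of_neg h, abs_of_neg h, min_eq_left (by linarith : v i ≤ ubar i)]
    rcases le_total (-v i) (ubar i) with h' | h'
    · rw [min_eq_left h', max_eq_right (by linarith)]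
      ring
    · rw [min_eq_right h', max_eq_left (by linarith)]
      ring
  · simp [h, hu.le]
  · rw [Real.sign_of_pos h, abs_of_pos h, mul_one, max_eq_right]
    exact (by linarith : -ubar i ≤ 0).trans (le_min h.le hu.le)

theorem lipschitzWith_dzVec {ubar : Fin m → ℝ} (hubar : ∀ i, 0 < ubar i) :
    LipschitzWith 2 (dzVec ubar) := by
  refine LipschitzWith.of_dist_le_mul fun v w => ?_
  have hd : 0 ≤ dist v w := dist_nonneg
  refine (dist_pi_le_iff (by positivity)).2 fun i => ?_
  have h1 : |v i - w i| ≤ dist v w := by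
    rw [← Real.dist_eq]
    exact dist_le_pi_dist v w i
  have h2 : |satVec ubar v i - satVec ubar w i| ≤ |v i - w i| := by
    rw [satVec_apply_eq_max_min hubar, satVec_apply_eq_max_min hubar]
    refine (abs_max_sub_max_le_max _ _ _ _).trans ?_
    rw [sub_self, abs_zero, max_eq_right (abs_nonneg _)]
    refine (abs_min_sub_min_le_max _ _ _ _).trans ?_
    rw [sub_self, abs_zero, max_eq_left (abs_nonneg _)]
  have h3 : |dzVec ubar v i - dzVec ubar w i| ≤
      |satVec ubar v i - satVec ubar w i| + |v i - w i| := by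
    simp only [dzVec, Pi.sub_apply]
    rw [show satVec ubar v i - v i - (satVec ubar w i - w i) =
      (satVec ubar v i - satVec ubar w i) - (v i - w i) by ring]
    exact abs_sub _ _
  rw [Real.dist_eq]
  push_cast
  linarith

theorem exists_lipschitzWith_closedLoop_f (A : Matrix (BlockIndex n) (BlockIndex n) ℝ)
    (B : Matrix (BlockIndex n) (Fin m) ℝ) {ubar : Fin m → ℝ} (hubar : ∀ i, 0 < ubar i)
    (T₁ T₂ : Fin q → ℝ) (K : Matrix (Fin m) (BlockIndex n) ℝ) :
    ∃ L, LipschitzWith L (closedLoop A B ubar T₁ T₂ K).f := by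
  have hx : LipschitzWith 1 (ClState.xbar (n := n)) := by
    refine LipschitzWith.of_dist_le_mul fun x y => ?_
    rw [NNReal.coe_one, one_mul]
    refine (dist_pi_le_iff dist_nonneg).2 fun a => ?_
    rw [dist_eq_norm, dist_eq_norm]
    exact PiLp.norm_apply_le (x - y) (Sum.inl a)
  have hA := (clA A B K).mulVecLin.toContinuousLinearMap.lipschitz
  have hB := (clB B).mulVecLin.toContinuousLinearMap.lipschitz
  have hK := (clK K).mulVecLin.toContinuousLinearMap.lipschitz
  have hS : LipschitzWith 1 fun u : BlockIndex n ⊕ BlockIndex n → ℝ =>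
      (Sum.elim u (fun _ : Fin q => (-1 : ℝ))) := by
    refine LipschitzWith.of_dist_le_mul fun x y => ?_
    rw [NNReal.coe_one, one_mul]
    refine (dist_pi_le_iff dist_nonneg).2 fun a => ?_
    rcases a with a | a
    · exact dist_le_pi_dist x y a
    · simp
  have hL := PiLp.lipschitzWith_toLp 2 fun _ : (BlockIndex n ⊕ BlockIndex n) ⊕ Fin q => ℝ
  exact ⟨_, hL.comp (hS.comp ((hA.comp hx).add
    (hB.comp ((lipschitzWith_dzVec hubar).comp (hK.comp hx)))))⟩

theorem continuous_timer : Continuous (ClState.timer (n := n)) :=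
  continuous_pi fun i => (EuclideanSpace.proj (𝕜 := ℝ) (Sum.inr i)).continuous

theorem isClosed_timerSet (T₂ : Fin q → ℝ) : IsClosed (timerSet T₂) := by
  have : timerSet T₂ = Set.univ.pi fun i => Set.Icc 0 (T₂ i) := by
    ext τ
    simp only [timerSet, Set.mem_pi, Set.mem_univ, true_imp_iff, Set.mem_ofPred_eq]
  rw [this]
  exact isClosed_set_pi fun i _ => isClosed_Icc

theorem isCompact_timerSet (T₂ : Fin q → ℝ) : IsCompact (timerSet T₂) := by
  have : timerSet T₂ = Set.univ.pi fun i => Set.Icc 0 (T₂ i) := by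
    ext τ
    simp only [timerSet, Set.mem_pi, Set.mem_univ, true_imp_iff, Set.mem_ofPred_eq]
  rw [this]
  exact isCompact_univ_pi fun i => isCompact_Icc

theorem infDist_attractor {T₂ : Fin q → ℝ} {x : ClState n} (hx : x.timer ∈ timerSet T₂) :
    Metric.infDist x (attractor n T₂) = √(x.xbar ⬝ᵥ x.xbar) := by
  have hp : ClState.mk 0 x.timer ∈ attractor n T₂ := ⟨rfl, hx⟩
  have hsum : x.xbar ⬝ᵥ x.xbar = ∑ a, x (Sum.inl a) ^ 2 := by
    simp [dotProduct, ClState.xbar, sq]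
  refine le_antisymm ((Metric.infDist_le_dist_of_mem hp).trans (le_of_eq ?_))
    ((Metric.le_infDist ⟨_, hp⟩).2 fun y hy => ?_)
  · rw [EuclideanSpace.dist_eq, Fintype.sum_sum_type, hsum]
    simp [ClState.mk, ClState.timer]
  · rw [EuclideanSpace.dist_eq, Fintype.sum_sum_type, hsum]
    refine Real.sqrt_le_sqrt ?_
    have h0 : ∀ a, y (Sum.inl a) = 0 := fun a => congrFun hy.1 a
    have : 0 ≤ ∑ i : Fin q, dist (x (Sum.inr i)) (y (Sum.inr i)) ^ 2 := by positivity
    simpa [h0, Real.dist_eq] using this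

variable {A : Matrix (BlockIndex n) (BlockIndex n) ℝ} {B : Matrix (BlockIndex n) (Fin m) ℝ}
  {ubar : Fin m → ℝ} {T₁ T₂ : Fin q → ℝ} {K : Matrix (Fin m) (BlockIndex n) ℝ}

theorem isClosed_closedLoop_C : IsClosed (closedLoop A B ubar T₁ T₂ K).C :=
  (isClosed_timerSet T₂).preimage continuous_timer

theorem mem_C_of_mem_D {x : ClState n} (hx : x ∈ (closedLoop A B ubar T₁ T₂ K).D) :
    x ∈ (closedLoop A B ubar T₁ T₂ K).C :=
  hx.choose_spec.1

theorem mem_C_of_mem_G (hT₁ : ∀ i, 0 < T₁ i) {x g : ClState n}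
    (hg : g ∈ (closedLoop A B ubar T₁ T₂ K).G x) : g ∈ (closedLoop A B ubar T₁ T₂ K).C := by
  obtain ⟨-, i, hi, -, hri, hrk⟩ := hg
  intro k
  by_cases hk : k = i
  · subst hk
    exact ⟨(hT₁ k).le.trans hri.1, hri.2⟩
  · rw [hrk k hk]
    exact hi.1 k

theorem hasDerivWithinAt_coord {y : ℝ → ClState n} {y' : ClState n} {s : Set ℝ} {t : ℝ}
    (h : HasDerivWithinAt y y' s t) (a : (BlockIndex n ⊕ BlockIndex n) ⊕ Fin q) :
    HasDerivWithinAt (fun r => y r a) (y' a) s t :=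
  (EuclideanSpace.proj (𝕜 := ℝ) a).hasFDerivAt.comp_hasDerivWithinAt t h

theorem timer_of_flow {y : ℝ → ClState n} {a b : ℝ}
    (hy : ∀ t ∈ Set.Icc a b, HasDerivWithinAt y ((closedLoop A B ubar T₁ T₂ K).f (y t))
      (Set.Icc a b) t) {t : ℝ} (ht : t ∈ Set.Icc a b) (i : Fin q) :
    (y t).timer i = (y a).timer i - (t - a) := by
  have hd : ∀ t ∈ Set.Icc a b,
      HasDerivWithinAt (fun r => (y r).timer i + r) 0 (Set.Icc a b) t := by
    intro t ht
    have h := (hasDerivWithinAt_coord (hy t ht) (Sum.inr i)).add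
      (hasDerivWithinAt_id t (Set.Icc a b))
    have h0 : ((closedLoop A B ubar T₁ T₂ K).f (y t)) (Sum.inr i) + 1 = 0 := by
      simp [closedLoop, ClState.mk]
    rw [h0] at h
    exact h
  have := constant_of_has_deriv_right_zero (fun t ht => (hd t ht).continuousWithinAt)
    (fun t ht => (hd t (Set.Ico_subset_Icc_self ht)).mono_of_mem_nhdsWithin (by
      filter_upwards [self_mem_nhdsWithin, nhdsWithin_le_nhds (Iio_mem_nhds ht.2)] with r hr hrb
      exact ⟨ht.1.trans hr, (Set.mem_Iio.1 hrb).le⟩)) t ht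
  linarith

/-! ### Completeness of the maximal solutions -/

/-- All points of a solution lie in the flow set. -/
theorem mem_C_of_isSolution (hT₁ : ∀ i, 0 < T₁ i) {φ : HybridArc (ClState n)}
    (hφ : (closedLoop A B ubar T₁ T₂ K).IsSolution φ) :
    ∀ t j, (t, j) ∈ φ.dom → φ.val t j ∈ (closedLoop A B ubar T₁ T₂ K).C := by
  refine φ.isHybridTimeDomain.induction ?_ ?_ ?_
  · rcases hφ.initial with h | h
    · rwa [isClosed_closedLoop_C.closure_eq] at h
    · exact mem_C_of_mem_D h
  · intro j a b hab h ha
    rcases hab.eq_or_lt with rfl | hlt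
    · exact ha
    · exact hφ.mem_C_of_lt isClosed_closedLoop_C hlt h b ⟨hab, le_rfl⟩
  · intro t j h1 h2 _
    exact mem_C_of_mem_G hT₁ (hφ.jump t j h1 h2).2

/-- A solution does not flow on beyond a point from which it jumps, because a timer has expired
there. -/
theorem le_of_jump (hT₁ : ∀ i, 0 < T₁ i) (hubar : ∀ i, 0 < ubar i) {φ : HybridArc (ClState n)}
    (hφ : (closedLoop A B ubar T₁ T₂ K).IsSolution φ) (t r : ℝ) (j : ℕ) (h : (t, j) ∈ φ.dom)
    (h' : (t, j + 1) ∈ φ.dom) (hr : (r, j) ∈ φ.dom) : r ≤ t := by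
  by_contra! hlt
  obtain ⟨L, hL⟩ := exists_lipschitzWith_closedLoop_f A B hubar T₁ T₂ K
  obtain ⟨i, hi⟩ := (hφ.jump t j h h').1
  have h1 := timer_of_flow (hφ.hasDerivWithinAt hL.continuous
    (φ.isHybridTimeDomain.Icc_subset h hr)) ⟨hlt.le, le_rfl⟩ i
  have h2 := (mem_C_of_isSolution hT₁ hφ r j hr i).1
  have h3 := hi.2
  linarith

theorem closedLoop_G_nonempty (hT : ∀ i, T₁ i ≤ T₂ i) {x : ClState n}
    (hx : x ∈ (closedLoop A B ubar T₁ T₂ K).D) :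
    ((closedLoop A B ubar T₁ T₂ K).G x).Nonempty := by
  obtain ⟨i, hi⟩ := hx
  refine ⟨ClState.mk (Sum.elim x.xp (errReset i x.err)) (Function.update x.timer i (T₁ i)), rfl, i,
    hi, rfl, ?_, ?_⟩
  · change Function.update x.timer i (T₁ i) i ∈ _
    rw [Function.update_self]
    exact ⟨le_rfl, hT i⟩
  · intro k hk
    change Function.update x.timer i (T₁ i) k = _
    rw [Function.update_of_ne hk]

/-- Maximal solutions are complete: as long as no timer has expired they can be prolonged by
flowing, and when a timer expires they can be prolonged by a jump. -/
theorem isComplete_of_isMaximalSolution (hubar : ∀ i, 0 < ubar i) (hT₁ : ∀ i, 0 < T₁ i)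
    (hT : ∀ i, T₁ i ≤ T₂ i) {φ : HybridArc (ClState n)}
    (hφ : (closedLoop A B ubar T₁ T₂ K).IsMaximalSolution φ) : φ.IsComplete := by
  intro hbdd
  have hdom := φ.isHybridTimeDomain
  obtain ⟨L, hL⟩ := exists_lipschitzWith_closedLoop_f A B hubar T₁ T₂ K
  have hmemC := mem_C_of_isSolution hT₁ hφ.1
  obtain ⟨C, hC⟩ := hbdd.image_fst.bddAbove
  have hC1 : ∀ p ∈ φ.dom, p.1 ≤ C := fun p hp => hC ⟨p, hp, rfl⟩
  have hfin : (Prod.snd '' φ.dom).Finite := hbdd.image_snd.bddAbove.finite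
  obtain ⟨J, ⟨⟨t₀, J'⟩, ht₀, hJ'⟩, hJmax⟩ := Set.exists_max_image _ id hfin (hdom.1.image _)
  obtain rfl : J' = J := hJ'
  have hJ : ∀ p ∈ φ.dom, p.2 ≤ J' := fun p hp => hJmax _ ⟨p, hp, rfl⟩
  obtain ⟨s, hst, hmin, hIcc, -⟩ := hdom.exists_start ht₀
  have hs : (s, J') ∈ φ.dom := hIcc s ⟨le_rfl, hst⟩
  have hle : ∀ p ∈ φ.dom, p.2 < J' → p.1 ≤ s := fun p hp hlt =>
    hdom.le_of_lt (le_of_jump hT₁ hubar hφ.1) hs (r := p.1) (k := p.2) hp hlt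
  set x := φ.val s J' with hx
  have hflow : ∀ r, (r, J') ∈ φ.dom → ∀ i, (φ.val r J').timer i = x.timer i - (r - s) :=
    fun r hr i => timer_of_flow (hφ.1.hasDerivWithinAt hL.continuous (hdom.Icc_subset hs hr))
      ⟨hmin r hr, le_rfl⟩ i
  have reach : ∀ T, (∀ r, (r, J') ∈ φ.dom → r ≤ T) → (∀ i, T - s ≤ x.timer i) →
      (T, J') ∈ φ.dom := by
    intro T hT hTx
    obtain ⟨y, hys, hy⟩ := hL.exists_hasDerivWithinAt_Icc s T x
    refine hφ.mem_dom_of_flow hL hs hmin hJ hle hT hys hy fun t ht i => ?_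
    have h1 := timer_of_flow hy ht i
    have h2 := hmemC s J' hs i
    have h3 := hTx i
    have h4 := ht.1
    have h5 := ht.2
    rw [hys] at h1
    rw [h1]
    exact ⟨by linarith, by linarith [h2.2]⟩
  rcases isEmpty_or_nonempty (Fin q) with hq | hq
  · have := hC1 _ (reach (C + 1) (fun r hr => (hC1 _ hr).trans (by linarith)) fun i => hq.elim i)
    simp at this
    linarith
  · obtain ⟨i, hi⟩ := Finite.exists_min x.timer
    have hTi : (s + x.timer i, J') ∈ φ.dom := by
      refine reach _ (fun r hr => ?_) fun k => by linarith [hi k]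
      have h1 := hflow r hr i
      have h2 := (hmemC r J' hr i).1
      linarith
    have hD : φ.val (s + x.timer i) J' ∈ (closedLoop A B ubar T₁ T₂ K).D := by
      refine ⟨i, hmemC _ _ hTi, ?_⟩
      rw [hflow _ hTi i]
      ring
    obtain ⟨g, hg⟩ := closedLoop_G_nonempty hT hD
    exact hφ.not_mem_D_of_last hTi hJ hg hD

end ClosedLoop

/-! ### Quadratic forms -/

section QuadraticForms

variable {ι : Type*} [Fintype ι]

theorem quadForm_smul (M : Matrix ι ι ℝ) (r : ℝ) (z : ι → ℝ) :
    (r • z) ⬝ᵥ (M *ᵥ (r • z)) = r ^ 2 * (z ⬝ᵥ (M *ᵥ z)) := by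
  rw [mulVec_smul, smul_dotProduct, dotProduct_smul]
  simp only [smul_eq_mul]
  ring

theorem dotProduct_self_nonneg' (z : ι → ℝ) : 0 ≤ z ⬝ᵥ z :=
  Finset.sum_nonneg fun i _ => mul_self_nonneg (z i)

theorem dotProduct_self_pos_of_ne_zero {z : ι → ℝ} (hz : z ≠ 0) : 0 < z ⬝ᵥ z :=
  lt_of_le_of_ne (dotProduct_self_nonneg' z) fun h => hz (dotProduct_self_eq_zero.1 h.symm)

theorem exists_smul_dotProduct_self_eq_one {z : ι → ℝ} (hz : z ≠ 0) :
    ∃ u : ι → ℝ, u ⬝ᵥ u = 1 ∧ z = √(z ⬝ᵥ z) • u := by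
  have h := dotProduct_self_pos_of_ne_zero hz
  have hs : 0 < √(z ⬝ᵥ z) := Real.sqrt_pos.2 h
  refine ⟨(√(z ⬝ᵥ z))⁻¹ • z, ?_, ?_⟩
  · rw [smul_dotProduct, dotProduct_smul, smul_eq_mul, smul_eq_mul, ← mul_assoc, ← mul_inv,
      Real.mul_self_sqrt h.le, inv_mul_cancel₀ h.ne']
  · rw [smul_smul, mul_inv_cancel₀ hs.ne', one_smul]

theorem isCompact_unitSphere : IsCompact {z : ι → ℝ | z ⬝ᵥ z = 1} := by
  refine (isCompact_univ_pi fun _ : ι => isCompact_Icc (a := (-1 : ℝ)) (b := 1)).of_isClosed_subset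
    (isClosed_eq (by fun_prop) continuous_const) fun z hz i _ => ?_
  have h1 : z i * z i ≤ z ⬝ᵥ z :=
    Finset.single_le_sum (f := fun i => z i * z i) (fun i _ => mul_self_nonneg (z i))
      (Finset.mem_univ i)
  rw [show z ⬝ᵥ z = 1 from hz] at h1
  exact ⟨by nlinarith, by nlinarith⟩

variable {α : Type*} [TopologicalSpace α] {T : Set α} {M : α → Matrix ι ι ℝ}

/-- Positive definiteness of a continuous family of quadratic forms is uniform on compact sets. -/
theorem exists_pos_mul_le_quadForm (hT : IsCompact T) (hM : Continuous M)
    (hpos : ∀ τ ∈ T, ∀ z, z ≠ 0 → 0 < z ⬝ᵥ (M τ *ᵥ z)) :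
    ∃ c > 0, ∀ τ ∈ T, ∀ z, c * (z ⬝ᵥ z) ≤ z ⬝ᵥ (M τ *ᵥ z) := by
  have hcont : Continuous fun p : α × (ι → ℝ) => p.2 ⬝ᵥ (M p.1 *ᵥ p.2) := by fun_prop
  rcases (T ×ˢ {z : ι → ℝ | z ⬝ᵥ z = 1}).eq_empty_or_nonempty with he | hne
  · refine ⟨1, one_pos, fun τ hτ z => ?_⟩
    by_cases hz : z = 0
    · simp [hz]
    · obtain ⟨u, hu, -⟩ := exists_smul_dotProduct_self_eq_one hz
      have hmem : (τ, u) ∈ T ×ˢ {z : ι → ℝ | z ⬝ᵥ z = 1} := ⟨hτ, hu⟩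
      simp [he] at hmem
  · obtain ⟨⟨τ₀, z₀⟩, ⟨hτ₀, hz₀⟩, hmin⟩ :=
      (hT.prod isCompact_unitSphere).exists_isMinOn hne hcont.continuousOn
    refine ⟨z₀ ⬝ᵥ (M τ₀ *ᵥ z₀), hpos τ₀ hτ₀ z₀ ?_, fun τ hτ z => ?_⟩
    · rintro rfl
      simp at hz₀
    by_cases hz : z = 0
    · simp [hz]
    · obtain ⟨u, hu, hzu⟩ := exists_smul_dotProduct_self_eq_one hz
      have h1 : z₀ ⬝ᵥ (M τ₀ *ᵥ z₀) ≤ u ⬝ᵥ (M τ *ᵥ u) := hmin (a := (τ, u)) ⟨hτ, hu⟩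
      have h2 := quadForm_smul (M τ) (√(z ⬝ᵥ z)) u
      rw [← hzu, Real.sq_sqrt (dotProduct_self_nonneg' z)] at h2
      rw [h2, mul_comm]
      exact mul_le_mul_of_nonneg_left h1 (dotProduct_self_nonneg' z)

theorem exists_quadForm_le_mul (hT : IsCompact T) (hM : Continuous M) :
    ∃ c > 0, ∀ τ ∈ T, ∀ z, z ⬝ᵥ (M τ *ᵥ z) ≤ c * (z ⬝ᵥ z) := by
  have hcont : Continuous fun p : α × (ι → ℝ) => p.2 ⬝ᵥ (M p.1 *ᵥ p.2) := by fun_prop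
  obtain ⟨C, hC⟩ := (hT.prod isCompact_unitSphere).exists_bound_of_continuousOn hcont.continuousOn
  refine ⟨|C| + 1, by positivity, fun τ hτ z => ?_⟩
  by_cases hz : z = 0
  · simp [hz]
  · obtain ⟨u, hu, hzu⟩ := exists_smul_dotProduct_self_eq_one hz
    have h1 : u ⬝ᵥ (M τ *ᵥ u) ≤ |C| + 1 := by
      have h := hC (τ, u) ⟨hτ, hu⟩
      have := (le_abs_self _).trans h
      have := le_abs_self C
      dsimp only at *
      linarith
    have h2 := quadForm_smul (M τ) (√(z ⬝ᵥ z)) u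
    rw [← hzu, Real.sq_sqrt (dotProduct_self_nonneg' z)] at h2
    rw [h2, mul_comm]
    exact mul_le_mul_of_nonneg_right h1 (dotProduct_self_nonneg' z)

theorem hasDerivWithinAt_quadForm {N : ℝ → Matrix ι ι ℝ} {N' : Matrix ι ι ℝ} {v : ℝ → ι → ℝ}
    {v' : ι → ℝ} {s : Set ℝ} {t : ℝ}
    (hN : ∀ i j, HasDerivWithinAt (fun r => N r i j) (N' i j) s t)
    (hv : ∀ i, HasDerivWithinAt (fun r => v r i) (v' i) s t) :
    HasDerivWithinAt (fun r => v r ⬝ᵥ (N r *ᵥ v r))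
      (v' ⬝ᵥ (N t *ᵥ v t) + v t ⬝ᵥ (N' *ᵥ v t) + v t ⬝ᵥ (N t *ᵥ v')) s t := by
  have h : HasDerivWithinAt (fun r => ∑ i, v r i * ∑ j, N r i j * v r j)
      (∑ i, (v' i * ∑ j, N t i j * v t j +
        v t i * ∑ j, (N' i j * v t j + N t i j * v' j))) s t :=
    HasDerivWithinAt.fun_sum fun i _ => (hv i).mul
      (HasDerivWithinAt.fun_sum fun j _ => (hN i j).mul (hv j))
  refine h.congr_deriv ?_
  simp only [dotProduct, mulVec, Finset.sum_add_distrib, mul_add]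
  ring

end QuadraticForms

/-- Exponential decay of a function that satisfies `g' ≤ -γ g` only where `g ≤ μ`, from an initial
value at most `μ`. -/
theorem le_exp_mul_of_hasDerivWithinAt {g g' : ℝ → ℝ} {a b γ μ : ℝ} (hab : a ≤ b) (hγ : 0 < γ)
    (hμ : 0 < μ) (hg : ∀ t ∈ Set.Icc a b, HasDerivWithinAt g (g' t) (Set.Icc a b) t)
    (ha : g a ≤ μ) (hle : ∀ t ∈ Set.Icc a b, g t ≤ μ → g' t ≤ -γ * g t) :
    g b ≤ Real.exp (-γ * (b - a)) * g a := by
  have hcont : ContinuousOn g (Set.Icc a b) := fun t ht => (hg t ht).continuousWithinAt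
  have hmem : ∀ t ∈ Set.Ico a b, Set.Icc a b ∈ nhdsWithin t (Set.Ici t) := by
    intro t ht
    filter_upwards [self_mem_nhdsWithin, nhdsWithin_le_nhds (Iio_mem_nhds ht.2)] with r hr hrb
    exact ⟨ht.1.trans hr, (Set.mem_Iio.1 hrb).le⟩
  -- where `g = μ` the derivative is negative, so `g` cannot cross the level `μ` upwards
  have hbar : ∀ t ∈ Set.Icc a b, g t ≤ μ :=
    image_le_of_deriv_right_lt_deriv_boundary (B := fun _ => μ) (B' := fun _ => 0) hcont
      (fun t ht => (hg t (Set.Ico_subset_Icc_self ht)).mono_of_mem_nhdsWithin (hmem t ht)) ha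
      (fun _ => hasDerivAt_const _ _) fun t ht heq => by
        have := hle t (Set.Ico_subset_Icc_self ht) heq.le
        rw [heq] at this
        nlinarith [mul_pos hγ hμ]
  have hd : ∀ t ∈ Set.Icc a b, HasDerivWithinAt (fun r => Real.exp (γ * (r - a)) * g r)
      (Real.exp (γ * (t - a)) * (γ * g t + g' t)) (Set.Icc a b) t := by
    intro t ht
    have h1 : HasDerivAt (fun r => Real.exp (γ * (r - a))) (Real.exp (γ * (t - a)) * (γ * 1)) t :=
      (((hasDerivAt_id t).sub_const a).const_mul γ).exp
    convert! h1.hasDerivWithinAt.mul (hg t ht) using 1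
    ring
  have hanti : AntitoneOn (fun r => Real.exp (γ * (r - a)) * g r) (Set.Icc a b) := by
    refine antitoneOn_of_hasDerivWithinAt_nonpos (convex_Icc a b)
      (fun t ht => (hd t ht).continuousWithinAt)
      (fun t ht => (hd t (interior_subset ht)).mono interior_subset) fun t ht => ?_
    have ht' := interior_subset ht
    have := hle t ht' (hbar t ht')
    exact mul_nonpos_of_nonneg_of_nonpos (Real.exp_pos _).le (by linarith)
  have h := hanti ⟨le_rfl, hab⟩ ⟨hab, le_rfl⟩ hab
  simp only [sub_self, mul_zero, Real.exp_zero, one_mul] at h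
  calc g b = Real.exp (-γ * (b - a)) * (Real.exp (γ * (b - a)) * g b) := by
        rw [← mul_assoc, ← Real.exp_add]
        simp
    _ ≤ _ := by gcongr

/-! ### The Lyapunov function -/

section ClosedLoop

variable {q m : ℕ} {n : Fin q → ℕ}

/-- The quadratic form `x̄ᵀ P̂(τ) x̄`, as a function of the state. -/
noncomputable def lyapunov (W : Matrix (BlockIndex n) (BlockIndex n) ℝ)
    (R : ∀ i : Fin q, Matrix (Fin (n i)) (Fin (n i)) ℝ) (σ : Fin q → ℝ) (x : ClState n) : ℝ :=
  x.xbar ⬝ᵥ (clockP W R σ x.timer *ᵥ x.xbar)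

variable {W : Matrix (BlockIndex n) (BlockIndex n) ℝ}
  {R : ∀ i : Fin q, Matrix (Fin (n i)) (Fin (n i)) ℝ} {σ : Fin q → ℝ}

theorem xbar_eq_sumElim (x : ClState n) : x.xbar = Sum.elim x.xp x.err := by
  ext (a | a) <;> rfl

theorem quadForm_fromBlocks_diag {ι κ : Type*} [Fintype ι] [Fintype κ] (M : Matrix ι ι ℝ)
    (N : Matrix κ κ ℝ) (x : ι → ℝ) (e : κ → ℝ) :
    Sum.elim x e ⬝ᵥ (fromBlocks M 0 0 N *ᵥ Sum.elim x e) = x ⬝ᵥ (M *ᵥ x) + e ⬝ᵥ (N *ᵥ e) := by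
  simp [fromBlocks_mulVec, sumElim_dotProduct_sumElim]

theorem lyapunov_eq (x : ClState n) :
    lyapunov W R σ x = x.xp ⬝ᵥ (W⁻¹ *ᵥ x.xp) + x.err ⬝ᵥ (clockR R σ x.timer *ᵥ x.err) := by
  rw [lyapunov, xbar_eq_sumElim, clockP, quadForm_fromBlocks_diag]

theorem quadForm_blockDiagonal' (M : ∀ i : Fin q, Matrix (Fin (n i)) (Fin (n i)) ℝ)
    (e : BlockIndex n → ℝ) :
    e ⬝ᵥ (blockDiagonal' M *ᵥ e) =
      ∑ i, (fun a => e ⟨i, a⟩) ⬝ᵥ (M i *ᵥ fun a => e ⟨i, a⟩) := by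
  simp only [dotProduct, mulVec, Fintype.sum_sigma]
  refine Finset.sum_congr rfl fun i _ => Finset.sum_congr rfl fun a _ => ?_
  congr 1
  rw [Finset.sum_eq_single i]
  · simp [blockDiagonal'_apply_eq]
  · intro k _ hk
    simp [blockDiagonal'_apply_ne _ _ _ hk.symm]
  · simp

theorem quadForm_clockR (τ : Fin q → ℝ) (e : BlockIndex n → ℝ) :
    e ⬝ᵥ (clockR R σ τ *ᵥ e) =
      ∑ i, Real.exp (σ i * τ i) * ((fun a => e ⟨i, a⟩) ⬝ᵥ (R i *ᵥ fun a => e ⟨i, a⟩)) := by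
  rw [clockR, quadForm_blockDiagonal']
  simp [smul_mulVec, dotProduct_smul]

theorem quadForm_nonneg {ι : Type*} [Fintype ι] {M : Matrix ι ι ℝ} (hM : M.PosDef) (z : ι → ℝ) :
    0 ≤ z ⬝ᵥ (M *ᵥ z) := by
  simpa using hM.posSemidef.dotProduct_mulVec_nonneg z

theorem quadForm_pos {ι : Type*} [Fintype ι] {M : Matrix ι ι ℝ} (hM : M.PosDef) {z : ι → ℝ}
    (hz : z ≠ 0) : 0 < z ⬝ᵥ (M *ᵥ z) := by
  simpa using hM.dotProduct_mulVec_pos hz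

theorem quadForm_clockR_nonneg (hR : ∀ i, (R i).PosDef) (τ : Fin q → ℝ) (e : BlockIndex n → ℝ) :
    0 ≤ e ⬝ᵥ (clockR R σ τ *ᵥ e) := by
  rw [quadForm_clockR]
  exact Finset.sum_nonneg fun i _ => mul_nonneg (Real.exp_pos _).le (quadForm_nonneg (hR i) _)

theorem quadForm_clockR_pos (hR : ∀ i, (R i).PosDef) (τ : Fin q → ℝ) {e : BlockIndex n → ℝ}
    (he : e ≠ 0) : 0 < e ⬝ᵥ (clockR R σ τ *ᵥ e) := by
  rw [quadForm_clockR]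
  obtain ⟨⟨i, a⟩, hi⟩ := Function.ne_iff.1 he
  refine Finset.sum_pos' (fun i _ => mul_nonneg (Real.exp_pos _).le (quadForm_nonneg (hR i) _))
    ⟨i, Finset.mem_univ i, mul_pos (Real.exp_pos _) (quadForm_pos (hR i) fun h => hi ?_)⟩
  exact congrFun h a

theorem quadForm_blockDiagonal_le_clockR (hR : ∀ i, (R i).PosDef) (hσ : ∀ i, 0 < σ i)
    {τ : Fin q → ℝ} (hτ : ∀ i, 0 ≤ τ i) (e : BlockIndex n → ℝ) :
    e ⬝ᵥ (blockDiagonal' R *ᵥ e) ≤ e ⬝ᵥ (clockR R σ τ *ᵥ e) := by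
  rw [quadForm_clockR, quadForm_blockDiagonal']
  refine Finset.sum_le_sum fun i _ => le_mul_of_one_le_left (quadForm_nonneg (hR i) _) ?_
  exact Real.one_le_exp (mul_nonneg (hσ i).le (hτ i))

theorem continuous_clockR : Continuous (clockR R σ) := by
  unfold clockR
  fun_prop

/-- The quadratic form `x̄ᵀ P̂(τ) x̄` is squeezed between multiples of `|x̄|²`, uniformly in `τ`. -/
theorem exists_lyapunov_bounds (hW : W.PosDef) (hR : ∀ i, (R i).PosDef) (T₂ : Fin q → ℝ) :
    ∃ c₁ > 0, ∃ c₂ > 0, ∀ x : ClState n, x.timer ∈ timerSet T₂ →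
      c₁ * (x.xbar ⬝ᵥ x.xbar) ≤ lyapunov W R σ x ∧
      lyapunov W R σ x ≤ c₂ * (x.xbar ⬝ᵥ x.xbar) := by
  have hcont : Continuous (clockP W R σ) := by
    have := continuous_clockR (R := R) (σ := σ)
    unfold clockP
    fun_prop
  obtain ⟨c₁, hc₁, h₁⟩ := exists_pos_mul_le_quadForm (isCompact_timerSet T₂) hcont
    (fun τ _ z hz => by
      obtain ⟨x, e, rfl⟩ : ∃ x e, z = Sum.elim x e := ⟨_, _, (Sum.elim_comp_inl_inr z).symm⟩
      rw [clockP, quadForm_fromBlocks_diag]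
      by_cases hx : x = 0
      · refine add_pos_of_nonneg_of_pos (quadForm_nonneg hW.inv x)
          (quadForm_clockR_pos hR τ fun he => hz ?_)
        ext (a | a) <;> simp [hx, he]
      · exact add_pos_of_pos_of_nonneg (quadForm_pos hW.inv hx) (quadForm_clockR_nonneg hR τ e))
  obtain ⟨c₂, hc₂, h₂⟩ := exists_quadForm_le_mul (isCompact_timerSet T₂) hcont
  exact ⟨c₁, hc₁, c₂, hc₂, fun x hx => ⟨h₁ _ hx _, h₂ _ hx _⟩⟩

end ClosedLoop

/-! ### Decay of the Lyapunov function along flows -/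

section ClosedLoop

variable {q m : ℕ} {n : Fin q → ℕ}
  {A : Matrix (BlockIndex n) (BlockIndex n) ℝ} {B : Matrix (BlockIndex n) (Fin m) ℝ}
  {ubar : Fin m → ℝ} {T₁ T₂ : Fin q → ℝ} {K : Matrix (Fin m) (BlockIndex n) ℝ}
  {W : Matrix (BlockIndex n) (BlockIndex n) ℝ}
  {R : ∀ i : Fin q, Matrix (Fin (n i)) (Fin (n i)) ℝ} {S : Matrix (Fin m) (Fin m) ℝ}
  {σ : Fin q → ℝ} {Z J : Matrix (Fin m) (BlockIndex n) ℝ} {μbar : ℝ}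

/-- The control input `K_cl x̄`, before saturation. -/
def controlInput (K : Matrix (Fin m) (BlockIndex n) ℝ) (x : ClState n) : Fin m → ℝ :=
  K *ᵥ x.xp - K *ᵥ x.err

/-- The derivative along flows of `x̄ᵀ P̂(τ) x̄`. -/
noncomputable def lyapunovDeriv (A : Matrix (BlockIndex n) (BlockIndex n) ℝ)
    (B : Matrix (BlockIndex n) (Fin m) ℝ) (ubar : Fin m → ℝ) (K : Matrix (Fin m) (BlockIndex n) ℝ)
    (W : Matrix (BlockIndex n) (BlockIndex n) ℝ)
    (R : ∀ i : Fin q, Matrix (Fin (n i)) (Fin (n i)) ℝ) (σ : Fin q → ℝ) (x : ClState n) : ℝ :=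
  2 * ((W⁻¹ *ᵥ x.xp) ⬝ᵥ ((A + B * K) *ᵥ x.xp - (B * K) *ᵥ x.err +
      B *ᵥ dzVec ubar (controlInput K x))) +
    2 * (x.err ⬝ᵥ (clockR R σ x.timer *ᵥ (A *ᵥ x.err))) -
    x.err ⬝ᵥ ((sigmaMat n σ * clockR R σ x.timer) *ᵥ x.err)

theorem closedLoop_f_eq (x : ClState n) :
    (closedLoop A B ubar T₁ T₂ K).f x =
      ClState.mk (Sum.elim ((A + B * K) *ᵥ x.xp - (B * K) *ᵥ x.err +
        B *ᵥ dzVec ubar (controlInput K x)) (A *ᵥ x.err)) (fun _ => -1) := by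
  have hK : clK K *ᵥ x.xbar = controlInput K x := by
    rw [xbar_eq_sumElim, clK, fromCols_mulVec_sumElim, neg_mulVec, controlInput, sub_eq_add_neg]
  have : clA A B K *ᵥ x.xbar + clB B *ᵥ dzVec ubar (clK K *ᵥ x.xbar) =
      Sum.elim ((A + B * K) *ᵥ x.xp - (B * K) *ᵥ x.err +
        B *ᵥ dzVec ubar (controlInput K x)) (A *ᵥ x.err) := by
    rw [hK, xbar_eq_sumElim, clA, clB, fromBlocks_mulVec, fromRows_mulVec]
    ext (a | a)
    · simp [neg_mulVec, sub_eq_add_neg]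
    · simp
  rw [← this]
  rfl

theorem clockR_transpose (hR : ∀ i, (R i).PosDef) (τ : Fin q → ℝ) :
    (clockR R σ τ)ᵀ = clockR R σ τ := by
  rw [clockR, blockDiagonal'_transpose]
  congr 1
  ext1 i
  have := (hR i).isHermitian.eq
  rw [conjTranspose_eq_transpose_of_trivial] at this
  rw [transpose_smul, this]

theorem sigmaMat_mul_clockR (τ : Fin q → ℝ) :
    sigmaMat n σ * clockR R σ τ =
      blockDiagonal' fun j => (σ j * Real.exp (σ j * τ j)) • R j := by
  rw [sigmaMat, clockR, ← blockDiagonal'_mul]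
  congr 1
  ext1 j
  rw [smul_mul, one_mul, smul_smul]

theorem hasDerivWithinAt_clockR {τ : ℝ → Fin q → ℝ} {s : Set ℝ} {t : ℝ}
    (hτ : ∀ i, HasDerivWithinAt (fun r => τ r i) (-1) s t) (a b : BlockIndex n) :
    HasDerivWithinAt (fun r => clockR R σ (τ r) a b)
      ((-(sigmaMat n σ * clockR R σ (τ t))) a b) s t := by
  rw [sigmaMat_mul_clockR]
  obtain ⟨i, a⟩ := a
  obtain ⟨j, b⟩ := b
  by_cases h : i = j
  · subst h
    simp only [clockR, blockDiagonal'_apply_eq, Matrix.neg_apply, Matrix.smul_apply, smul_eq_mul]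
    refine ((((hτ i).const_mul (σ i)).exp).mul_const (R i a b)).congr_deriv ?_
    ring
  · simp only [clockR, blockDiagonal'_apply_ne _ _ _ h, Matrix.neg_apply, neg_zero]
    exact hasDerivWithinAt_const _ _ _

theorem hasDerivWithinAt_lyapunov (hW : W.PosDef) (hR : ∀ i, (R i).PosDef) {y : ℝ → ClState n}
    {s : Set ℝ} {t : ℝ}
    (hy : HasDerivWithinAt y ((closedLoop A B ubar T₁ T₂ K).f (y t)) s t) :
    HasDerivWithinAt (fun r => lyapunov W R σ (y r)) (lyapunovDeriv A B ubar K W R σ (y t)) s t := by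
  rw [closedLoop_f_eq] at hy
  have hτ : ∀ i, HasDerivWithinAt (fun r => (y r).timer i) (-1) s t := fun i =>
    hasDerivWithinAt_coord hy (Sum.inr i)
  have h1 := hasDerivWithinAt_quadForm (N := fun _ => W⁻¹) (N' := 0) (v := fun r => (y r).xp)
    (fun i j => hasDerivWithinAt_const _ _ _)
    (fun a => hasDerivWithinAt_coord hy (Sum.inl (Sum.inl a)))
  have h2 := hasDerivWithinAt_quadForm (N := fun r => clockR R σ (y r).timer)
    (v := fun r => (y r).err) (hasDerivWithinAt_clockR hτ)
    (fun a => hasDerivWithinAt_coord hy (Sum.inl (Sum.inr a)))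
  simp only [lyapunov_eq]
  refine (h1.add h2).congr_deriv ?_
  set x := y t
  set x' := (A + B * K) *ᵥ x.xp - (B * K) *ᵥ x.err + B *ᵥ dzVec ubar (controlInput K x) with hx'
  change x' ⬝ᵥ (W⁻¹ *ᵥ x.xp) + x.xp ⬝ᵥ ((0 : Matrix _ _ ℝ) *ᵥ x.xp) + x.xp ⬝ᵥ (W⁻¹ *ᵥ x') +
    ((A *ᵥ x.err) ⬝ᵥ (clockR R σ x.timer *ᵥ x.err) +
      x.err ⬝ᵥ (-(sigmaMat n σ * clockR R σ x.timer) *ᵥ x.err) +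
      x.err ⬝ᵥ (clockR R σ x.timer *ᵥ (A *ᵥ x.err))) = _
  have hWs : (W⁻¹)ᵀ = W⁻¹ := by
    have := hW.inv.isHermitian.eq
    rwa [conjTranspose_eq_transpose_of_trivial] at this
  have e1 : x.xp ⬝ᵥ (W⁻¹ *ᵥ x') = x' ⬝ᵥ (W⁻¹ *ᵥ x.xp) := by
    conv_lhs => rw [← hWs]
    exact dotProduct_transpose_mulVec _ _ _
  have e2 : (A *ᵥ x.err) ⬝ᵥ (clockR R σ x.timer *ᵥ x.err) =
      x.err ⬝ᵥ (clockR R σ x.timer *ᵥ (A *ᵥ x.err)) := by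
    conv_lhs => rw [← clockR_transpose hR]
    exact dotProduct_transpose_mulVec _ _ _
  rw [lyapunovDeriv, ← hx', e1, e2, zero_mulVec, dotProduct_zero, neg_mulVec, dotProduct_neg,
    dotProduct_comm x']
  ring

theorem quadForm_clockM (hW : Wᵀ = W) (τ : Fin q → ℝ) (w e : BlockIndex n → ℝ) (ζ : Fin m → ℝ) :
    Sum.elim (Sum.elim w e) ζ ⬝ᵥ (clockM A B K W R S σ Z J τ *ᵥ Sum.elim (Sum.elim w e) ζ) =
      2 * (w ⬝ᵥ ((A + B * K) *ᵥ (W *ᵥ w) - (B * K) *ᵥ e + B *ᵥ (S *ᵥ ζ))) +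
        2 * (e ⬝ᵥ (clockR R σ τ *ᵥ (A *ᵥ e))) -
        e ⬝ᵥ ((sigmaMat n σ * clockR R σ τ) *ᵥ e) -
        2 * (ζ ⬝ᵥ (K *ᵥ (W *ᵥ w) - K *ᵥ e + (Z *ᵥ w + J *ᵥ e) + S *ᵥ ζ)) := by
  have hWK : w ⬝ᵥ (W *ᵥ (Kᵀ *ᵥ ζ)) = ζ ⬝ᵥ (K *ᵥ (W *ᵥ w)) := by
    conv_lhs => rw [← hW]
    rw [dotProduct_transpose_mulVec, dotProduct_comm, dotProduct_transpose_mulVec]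
  have hrow : ζ ⬝ᵥ ((fromRows (B * S - W * Kᵀ - Zᵀ) (Kᵀ - Jᵀ))ᵀ *ᵥ Sum.elim w e) =
      w ⬝ᵥ ((B * S - W * Kᵀ - Zᵀ) *ᵥ ζ) + e ⬝ᵥ ((Kᵀ - Jᵀ) *ᵥ ζ) := by
    rw [dotProduct_transpose_mulVec, fromRows_mulVec, sumElim_dotProduct_sumElim]
  simp only [clockM, fromBlocks_mulVec, Sum.elim_comp_inl, Sum.elim_comp_inr, fromRows_mulVec,
    sumElim_dotProduct_sumElim, dotProduct_add, hrow]
  simp only [matHe, dotProduct_add, dotProduct_sub, dotProduct_neg, add_mulVec, sub_mulVec,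
    neg_mulVec, transpose_neg, dotProduct_transpose_mulVec, smul_mulVec, dotProduct_smul,
    ← mulVec_mulVec, hWK, smul_eq_mul]
  ring

/-- The local sector property of the deadzone. -/
theorem dzVec_mul_le (hubar : ∀ i, 0 < ubar i) (v : Fin m → ℝ) {i : Fin m} {h : ℝ}
    (hh : |h| ≤ ubar i) : dzVec ubar v i * (v i + h + dzVec ubar v i) ≤ 0 := by
  have h1 := (abs_le.1 hh).1
  have h2 := (abs_le.1 hh).2
  have hu := hubar i
  simp only [dzVec, Pi.sub_apply, satVec_apply_eq_max_min hubar]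
  rcases le_total (v i) (ubar i) with hv | hv
  · rw [min_eq_left hv]
    rcases le_total (-ubar i) (v i) with hv' | hv'
    · rw [max_eq_right hv']
      simp
    · rw [max_eq_left hv']
      exact mul_nonpos_of_nonneg_of_nonpos (by linarith) (by linarith)
  · rw [min_eq_right hv, max_eq_right (by linarith)]
    exact mul_nonpos_of_nonpos_of_nonneg (by linarith) (by linarith)

/-- The first matrix inequality bounds the auxiliary feedback `Z w + J e` by the saturation
levels on the ellipsoid of size `μbar`. -/
theorem abs_le_ubar_of_inclusionLMI (hubar : ∀ i, 0 < ubar i) (hμ : 0 < μbar) {i : Fin m}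
    (hI : (inclusionLMI ubar W R Z J μbar i).PosSemidef) {w e : BlockIndex n → ℝ}
    (hwe : w ⬝ᵥ (W *ᵥ w) + e ⬝ᵥ (blockDiagonal' R *ᵥ e) ≤ μbar) :
    |(Z *ᵥ w + J *ᵥ e) i| ≤ ubar i := by
  set h := (Z *ᵥ w + J *ᵥ e) i with hh
  have hu := hubar i
  -- the minimizer of the quadratic form over the last coordinate
  set s := -(h * μbar / ubar i ^ 2) with hs
  have hq := hI.dotProduct_mulVec_nonneg (Sum.elim (Sum.elim w e) fun _ => s)
  have hval : Sum.elim (Sum.elim w e) (fun _ => s) ⬝ᵥ (inclusionLMI ubar W R Z J μbar i *ᵥ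
      Sum.elim (Sum.elim w e) fun _ => s) =
      w ⬝ᵥ (W *ᵥ w) + e ⬝ᵥ (blockDiagonal' R *ᵥ e) + 2 * s * h + s ^ 2 * (ubar i ^ 2 / μbar) := by
    have hcol : ∀ (Y : Matrix (Fin m) (BlockIndex n) ℝ) (z : BlockIndex n → ℝ),
        z ⬝ᵥ (replicateCol (Fin 1) (Y i) *ᵥ fun _ => s) = s * (Y *ᵥ z) i := by
      intro Y z
      simp only [dotProduct, mulVec, replicateCol_apply, Finset.mul_sum, Fin.sum_univ_one]
      exact Finset.sum_congr rfl fun a _ => by ring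
    have hrow : (fun _ : Fin 1 => s) ⬝ᵥ ((fromRows (replicateCol (Fin 1) (Z i))
        (replicateCol (Fin 1) (J i)))ᵀ *ᵥ Sum.elim w e) = s * (Z *ᵥ w) i + s * (J *ᵥ e) i := by
      rw [dotProduct_transpose_mulVec, fromRows_mulVec, sumElim_dotProduct_sumElim, hcol, hcol]
    have hlast : (fun _ : Fin 1 => s) ⬝ᵥ (!![ubar i ^ 2 / μbar] *ᵥ fun _ => s) =
        s ^ 2 * (ubar i ^ 2 / μbar) := by
      simp [dotProduct, mulVec]
      ring
    rw [inclusionLMI, fromBlocks_mulVec, Sum.elim_comp_inl, Sum.elim_comp_inr,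
      sumElim_dotProduct_sumElim, dotProduct_add, dotProduct_add, quadForm_fromBlocks_diag, hrow,
      hlast, fromRows_mulVec, sumElim_dotProduct_sumElim, hcol, hcol, hh, Pi.add_apply]
    ring
  rw [star_trivial, hval] at hq
  have hsq : 2 * s * h + s ^ 2 * (ubar i ^ 2 / μbar) = -(h ^ 2 * μbar / ubar i ^ 2) := by
    rw [hs]
    field_simp
    ring
  have h1 : h ^ 2 * μbar / ubar i ^ 2 ≤ μbar := by linarith
  rw [div_le_iff₀ (by positivity), mul_comm] at h1
  exact abs_le_of_sq_le_sq (le_of_mul_le_mul_left h1 hμ) hu.le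

/-- On the sublevel set, the derivative of the Lyapunov function along flows is at most a negative
multiple of the function itself. -/
theorem exists_lyapunovDeriv_le (hubar : ∀ i, 0 < ubar i) (hW : W.PosDef)
    (hR : ∀ i, (R i).PosDef) (hSdiag : S.IsDiag) (hS : S.PosDef) (hσ : ∀ i, 0 < σ i)
    (hμbar : 0 < μbar) (hIncl : ∀ i : Fin m, (inclusionLMI ubar W R Z J μbar i).PosSemidef)
    (hM : ∀ τ ∈ timerSet T₂, (-(clockM A B K W R S σ Z J τ)).PosDef) :
    ∃ γ > 0, ∀ x : ClState n, x.timer ∈ timerSet T₂ → lyapunov W R σ x ≤ μbar →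
      lyapunovDeriv A B ubar K W R σ x ≤ -γ * lyapunov W R σ x := by
  have hWt : Wᵀ = W := by
    have := hW.isHermitian.eq
    rwa [conjTranspose_eq_transpose_of_trivial] at this
  have hWu : IsUnit W.det := (Matrix.isUnit_iff_isUnit_det W).1 hW.isUnit
  have hcont : Continuous fun τ => -(clockM A B K W R S σ Z J τ) := by
    have := continuous_clockR (R := R) (σ := σ)
    unfold clockM matHe
    fun_prop
  have hcont' : Continuous fun τ => fromBlocks W 0 0 (clockR R σ τ) := by
    have := continuous_clockR (R := R) (σ := σ)
    fun_prop
  obtain ⟨c, hc, hlow⟩ := exists_pos_mul_le_quadForm (isCompact_timerSet T₂) hcont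
    fun τ hτ z hz => quadForm_pos (hM τ hτ) hz
  obtain ⟨C, hC, hup⟩ := exists_quadForm_le_mul (isCompact_timerSet T₂) hcont'
  refine ⟨c / C, by positivity, fun x hx hxμ => ?_⟩
  -- the vector at which the matrix inequalities are evaluated
  set w := W⁻¹ *ᵥ x.xp with hw
  set e := x.err with he
  set d := dzVec ubar (controlInput K x) with hd
  set ζ : Fin m → ℝ := fun i => d i / S i i with hζ
  have hWw : W *ᵥ w = x.xp := by
    rw [hw, mulVec_mulVec, mul_nonsing_inv _ hWu, one_mulVec]
  have hSζ : S *ᵥ ζ = d := by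
    rw [← hSdiag.diagonal_diag]
    ext i
    rw [mulVec_diagonal, diag_apply, hζ]
    have := (hS.diag_pos (i := i)).ne'
    field_simp
  have hV : lyapunov W R σ x = w ⬝ᵥ (W *ᵥ w) + e ⬝ᵥ (clockR R σ x.timer *ᵥ e) := by
    rw [lyapunov_eq, ← hw, hWw, dotProduct_comm w]
  have hsector : ζ ⬝ᵥ (K *ᵥ (W *ᵥ w) - K *ᵥ e + (Z *ᵥ w + J *ᵥ e) + S *ᵥ ζ) ≤ 0 := by
    rw [hWw, hSζ]
    refine Finset.sum_nonpos fun i _ => ?_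
    have h1 := abs_le_ubar_of_inclusionLMI hubar hμbar (hIncl i) (w := w) (e := e) (by
      have := quadForm_blockDiagonal_le_clockR hR hσ (fun i => (hx i).1) e
      linarith)
    have h2 := dzVec_mul_le hubar (controlInput K x) h1
    have h3 := hS.diag_pos (i := i)
    have h4 : ζ i * (K *ᵥ x.xp - K *ᵥ e + (Z *ᵥ w + J *ᵥ e) + d) i =
        (d i * (controlInput K x i + (Z *ᵥ w + J *ᵥ e) i + d i)) / S i i := by
      rw [hζ, controlInput]
      simp only [Pi.add_apply, Pi.sub_apply]
      ring
    rw [h4]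
    exact div_nonpos_of_nonpos_of_nonneg h2 h3.le
  have hderiv := quadForm_clockM (A := A) (B := B) (K := K) (R := R) (S := S) (σ := σ) (Z := Z)
    (J := J) hWt x.timer w e ζ
  have hlow' := hlow x.timer hx (Sum.elim (Sum.elim w e) ζ)
  have hup' := hup x.timer hx (Sum.elim w e)
  rw [neg_mulVec, dotProduct_neg, hderiv, sumElim_dotProduct_sumElim] at hlow'
  rw [quadForm_fromBlocks_diag, ← hV] at hup'
  have hζ0 := dotProduct_self_nonneg' ζ
  have hcV : c / C * lyapunov W R σ x ≤ c * (Sum.elim w e ⬝ᵥ Sum.elim w e) := by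
    calc c / C * lyapunov W R σ x ≤ c / C * (C * (Sum.elim w e ⬝ᵥ Sum.elim w e)) := by gcongr
      _ = _ := by field_simp
  have hcζ := mul_nonneg hc.le hζ0
  rw [hSζ, hWw] at hlow'
  rw [hSζ, hWw] at hsector
  rw [lyapunovDeriv, ← hw, ← he, ← hd]
  linarith

theorem lyapunov_le_of_flow (hW : W.PosDef) (hR : ∀ i, (R i).PosDef) (hμbar : 0 < μbar) {γ : ℝ}
    (hγ : 0 < γ) (hdec : ∀ x : ClState n, x.timer ∈ timerSet T₂ → lyapunov W R σ x ≤ μbar →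
      lyapunovDeriv A B ubar K W R σ x ≤ -γ * lyapunov W R σ x) {y : ℝ → ClState n} {a b : ℝ}
    (hab : a ≤ b)
    (hy : ∀ t ∈ Set.Icc a b, HasDerivWithinAt y ((closedLoop A B ubar T₁ T₂ K).f (y t))
      (Set.Icc a b) t)
    (hyC : ∀ t ∈ Set.Icc a b, (y t).timer ∈ timerSet T₂) (ha : lyapunov W R σ (y a) ≤ μbar) :
    lyapunov W R σ (y b) ≤ Real.exp (-γ * (b - a)) * lyapunov W R σ (y a) :=
  le_exp_mul_of_hasDerivWithinAt hab hγ hμbar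
    (fun t ht => hasDerivWithinAt_lyapunov hW hR (hy t ht)) ha fun t ht => hdec _ (hyC t ht)

/-- The Lyapunov function does not increase at jumps: the timer that is reset enters it only
through the block of the error that is set to zero. -/
theorem lyapunov_le_of_jump (hR : ∀ i, (R i).PosDef) {x g : ClState n}
    (hg : g ∈ (closedLoop A B ubar T₁ T₂ K).G x) : lyapunov W R σ g ≤ lyapunov W R σ x := by
  obtain ⟨hxp, i, hi, herr, -, htimer⟩ := hg
  rw [lyapunov_eq, lyapunov_eq, hxp, quadForm_clockR, quadForm_clockR]
  refine add_le_add_right (Finset.sum_le_sum fun k _ => ?_) _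
  have hblock : (fun a => g.err ⟨k, a⟩) = if i = k then 0 else fun a => x.err ⟨k, a⟩ := by
    ext a
    rw [herr, errReset, mulVec, dotProduct, Fintype.sum_sigma, Finset.sum_eq_single k]
    · split_ifs with hik
      · simp [blockDiagonal'_apply_eq, hik]
      · simp [blockDiagonal'_apply_eq, hik, one_apply]
    · intro l _ hl
      simp [blockDiagonal'_apply_ne _ _ _ hl.symm]
    · simp
  rw [hblock]
  split_ifs with hik
  · simpa using mul_nonneg (Real.exp_pos _).le (quadForm_nonneg (hR k) _)
  · rw [htimer k (Ne.symm hik)]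

end ClosedLoop

/-! ### Exponential decay along solutions -/

section ClosedLoop

variable {q m : ℕ} {n : Fin q → ℕ}
  {A : Matrix (BlockIndex n) (BlockIndex n) ℝ} {B : Matrix (BlockIndex n) (Fin m) ℝ}
  {ubar : Fin m → ℝ} {T₁ T₂ : Fin q → ℝ} {K : Matrix (Fin m) (BlockIndex n) ℝ}
  {W : Matrix (BlockIndex n) (BlockIndex n) ℝ}
  {R : ∀ i : Fin q, Matrix (Fin (n i)) (Fin (n i)) ℝ} {σ : Fin q → ℝ} {μbar : ℝ}

/-- The sum of the timers decreases at rate `q` along flows and grows by at least `δ` at each jump,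
so that the number of jumps up to time `t` is at most affine in `t`. -/
theorem mul_jumps_le (hubar : ∀ i, 0 < ubar i) (hT₁ : ∀ i, 0 < T₁ i) {δ : ℝ}
    (hδ : ∀ i, δ ≤ T₁ i) {φ : HybridArc (ClState n)}
    (hφ : (closedLoop A B ubar T₁ T₂ K).IsSolution φ) {t : ℝ} {j : ℕ} (h : (t, j) ∈ φ.dom) :
    δ * j ≤ ∑ i, T₂ i + q * t := by
  obtain ⟨L, hL⟩ := exists_lipschitzWith_closedLoop_f A B hubar T₁ T₂ K
  have hmemC := mem_C_of_isSolution hT₁ hφ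
  have key : ∀ t j, (t, j) ∈ φ.dom → δ * j ≤ ∑ i, (φ.val t j).timer i + q * t := by
    refine φ.isHybridTimeDomain.induction ?_ ?_ ?_
    · simpa using Finset.sum_nonneg fun i _ =>
        (hmemC 0 0 φ.isHybridTimeDomain.zero_mem i).1
    · intro j a b hab hI ha
      have : ∑ i, (φ.val b j).timer i = ∑ i, (φ.val a j).timer i - q * (b - a) := by
        rw [Finset.sum_congr rfl fun i _ =>
          timer_of_flow (hφ.hasDerivWithinAt hL.continuous hI) ⟨hab, le_rfl⟩ i]
        simp only [Finset.sum_sub_distrib, Finset.sum_const, Finset.card_univ, Fintype.card_fin,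
          nsmul_eq_mul]
        ring
      rw [this]
      linarith
    · intro t j h1 h2 ih
      obtain ⟨-, i, hi, -, hri, hrk⟩ := (hφ.jump t j h1 h2).2
      have hsum : ∑ k, (φ.val t j).timer k + δ ≤ ∑ k, (φ.val t (j + 1)).timer k := by
        rw [← Finset.add_sum_erase _ _ (Finset.mem_univ i),
          ← Finset.add_sum_erase _ (fun k => (φ.val t (j + 1)).timer k) (Finset.mem_univ i),
          Finset.sum_congr rfl fun k hk => hrk k (Finset.ne_of_mem_erase hk), hi.2]
        linarith [hri.1, hδ i]
      push_cast
      linarith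
  exact (key t j h).trans (by gcongr with i; exact (hmemC t j h i).2)

theorem lyapunov_le_of_isSolution (hubar : ∀ i, 0 < ubar i) (hT₁ : ∀ i, 0 < T₁ i) (hW : W.PosDef)
    (hR : ∀ i, (R i).PosDef) (hμbar : 0 < μbar) {γ : ℝ} (hγ : 0 < γ)
    (hdec : ∀ x : ClState n, x.timer ∈ timerSet T₂ → lyapunov W R σ x ≤ μbar →
      lyapunovDeriv A B ubar K W R σ x ≤ -γ * lyapunov W R σ x) {φ : HybridArc (ClState n)}
    (hφ : (closedLoop A B ubar T₁ T₂ K).IsSolution φ) (h0 : lyapunov W R σ (φ.val 0 0) ≤ μbar) :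
    ∀ t j, (t, j) ∈ φ.dom →
      lyapunov W R σ (φ.val t j) ≤ Real.exp (-γ * t) * lyapunov W R σ (φ.val 0 0) := by
  obtain ⟨L, hL⟩ := exists_lipschitzWith_closedLoop_f A B hubar T₁ T₂ K
  have hmemC := mem_C_of_isSolution hT₁ hφ
  have hV0 : 0 ≤ lyapunov W R σ (φ.val 0 0) := by
    rw [lyapunov_eq]
    exact add_nonneg (quadForm_nonneg hW.inv _) (quadForm_clockR_nonneg hR _ _)
  refine φ.isHybridTimeDomain.induction (by simp) ?_ ?_
  · intro j a b hab hI ha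
    have ha0 : 0 ≤ a := φ.isHybridTimeDomain.2.1 _ (hI a ⟨le_rfl, hab⟩)
    have hexp : Real.exp (-γ * a) ≤ 1 :=
      Real.exp_le_one_iff.2 (by nlinarith [mul_nonneg hγ.le ha0])
    have haμ : lyapunov W R σ (φ.val a j) ≤ μbar :=
      (ha.trans (mul_le_of_le_one_left hV0 hexp)).trans h0
    have h := lyapunov_le_of_flow hW hR hμbar hγ hdec hab (hφ.hasDerivWithinAt hL.continuous hI)
      (fun t ht => hmemC t j (hI t ht)) haμ
    calc lyapunov W R σ (φ.val b j)
        ≤ Real.exp (-γ * (b - a)) * lyapunov W R σ (φ.val a j) := h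
      _ ≤ Real.exp (-γ * (b - a)) * (Real.exp (-γ * a) * lyapunov W R σ (φ.val 0 0)) := by gcongr
      _ = _ := by
        rw [← mul_assoc, ← Real.exp_add]
        ring_nf
  · intro t j h1 h2 ih
    exact (lyapunov_le_of_jump hR (hφ.jump t j h1 h2).2).trans ih

/-- The decay estimate in terms of the distance to the attractor and of hybrid time `t + j`. -/
theorem exists_infDist_le (hubar : ∀ i, 0 < ubar i) (hT₁ : ∀ i, 0 < T₁ i) (hW : W.PosDef)
    (hR : ∀ i, (R i).PosDef) (hμbar : 0 < μbar) {γ : ℝ} (hγ : 0 < γ)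
    (hdec : ∀ x : ClState n, x.timer ∈ timerSet T₂ → lyapunov W R σ x ≤ μbar →
      lyapunovDeriv A B ubar K W R σ x ≤ -γ * lyapunov W R σ x) :
    ∃ lam > 0, ∃ κ > 0, ∀ φ : HybridArc (ClState n),
      (closedLoop A B ubar T₁ T₂ K).IsSolution φ → lyapunov W R σ (φ.val 0 0) ≤ μbar →
      ∀ (t : ℝ) (j : ℕ), (t, j) ∈ φ.dom →
        Metric.infDist (φ.val t j) (attractor n T₂) ≤
          κ * Real.exp (-lam * (t + j)) * Metric.infDist (φ.val 0 0) (attractor n T₂) := by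
  obtain ⟨c₁, hc₁, c₂, hc₂, hbd⟩ := exists_lyapunov_bounds (σ := σ) hW hR T₂
  obtain ⟨δ, hδ0, hδ⟩ : ∃ δ > 0, ∀ i, δ ≤ T₁ i := by
    rcases isEmpty_or_nonempty (Fin q) with hq | hq
    · exact ⟨1, one_pos, fun i => hq.elim i⟩
    · obtain ⟨i, hi⟩ := Finite.exists_min T₁
      exact ⟨T₁ i, hT₁ i, hi⟩
  -- `lam * (t + j) ≤ γ / 2 * t + M` by the bound on the number of jumps
  set lam := γ / 2 * δ / (δ + q) with hlam
  set M := lam * (∑ i, T₂ i) / δ with hMdef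
  have hδq : 0 < δ + q := by positivity
  refine ⟨lam, by positivity, √(c₂ / c₁) * Real.exp M, by positivity, fun φ hφ h0 t j h => ?_⟩
  have hmemC := mem_C_of_isSolution hT₁ hφ
  have hx0 := hmemC 0 0 φ.isHybridTimeDomain.zero_mem
  have hxt := hmemC t j h
  have hV := lyapunov_le_of_isSolution hubar hT₁ hW hR hμbar hγ hdec hφ h0 t j h
  have hjump := mul_jumps_le hubar hT₁ hδ hφ h
  rw [infDist_attractor hxt, infDist_attractor hx0]
  set X := (φ.val t j).xbar ⬝ᵥ (φ.val t j).xbar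
  set X₀ := (φ.val 0 0).xbar ⬝ᵥ (φ.val 0 0).xbar
  have htime : lam * (t + j) ≤ γ / 2 * t + M := by
    have hj : (j : ℝ) ≤ (∑ i, T₂ i + q * t) / δ := by
      rw [le_div_iff₀ hδ0]
      linarith
    calc lam * (t + j) ≤ lam * (t + (∑ i, T₂ i + q * t) / δ) := by
          have : 0 < lam := by positivity
          gcongr
      _ = _ := by
          rw [hMdef, hlam]
          field_simp
          ring
  have hX : X ≤ c₂ / c₁ * (Real.exp (-γ * t) * X₀) := by
    have h1 := (hbd _ hxt).1
    have h2 := mul_le_mul_of_nonneg_left (hbd _ hx0).2 (Real.exp_pos (-γ * t)).le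
    rw [div_mul_eq_mul_div, le_div_iff₀ hc₁]
    linarith
  have hsqrt : √(Real.exp (-γ * t)) = Real.exp (-(γ / 2) * t) := by
    rw [← Real.exp_half]
    ring_nf
  calc √X ≤ √(c₂ / c₁ * (Real.exp (-γ * t) * X₀)) := Real.sqrt_le_sqrt hX
    _ = √(c₂ / c₁) * (Real.exp (-(γ / 2) * t) * √X₀) := by
      rw [Real.sqrt_mul (by positivity), Real.sqrt_mul (Real.exp_pos _).le, hsqrt]
    _ ≤ √(c₂ / c₁) * (Real.exp (M + -lam * (t + j)) * √X₀) := by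
      gcongr
      linarith
    _ = _ := by
      rw [Real.exp_add]
      ring

theorem convergesTo_of_infDist_le {X : Type*} [PseudoMetricSpace X] {φ : HybridArc X} {S : Set X}
    {κ lam d : ℝ} (hlam : 0 < lam) (h : ∀ (t : ℝ) (j : ℕ), (t, j) ∈ φ.dom →
      Metric.infDist (φ.val t j) S ≤ κ * Real.exp (-lam * (t + j)) * d) : φ.ConvergesTo S := by
  intro ε hε
  have htend : Filter.Tendsto (fun r : ℝ => κ * Real.exp (-lam * r) * d) Filter.atTop (nhds 0) := by
    have h1 : Filter.Tendsto (fun r : ℝ => Real.exp (-lam * r)) Filter.atTop (nhds 0) :=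
      Real.tendsto_exp_atBot.comp (Filter.tendsto_id.const_mul_atTop_of_neg (by linarith))
    simpa using (h1.const_mul κ).mul_const d
  obtain ⟨N, hN⟩ := Filter.eventually_atTop.1 (htend.eventually_lt_const hε)
  exact ⟨N, fun t j htj hle => (h t j htj).trans_lt (hN _ hle)⟩

end ClosedLoop

theorem theorem1 {q m : ℕ} {n : Fin q → ℕ}
    (A : Matrix (BlockIndex n) (BlockIndex n) ℝ) (B : Matrix (BlockIndex n) (Fin m) ℝ)
    (ubar : Fin m → ℝ) (hubar : ∀ i, 0 < ubar i)
    (T₁ T₂ : Fin q → ℝ) (hT₁ : ∀ i, 0 < T₁ i) (hT : ∀ i, T₁ i ≤ T₂ i)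
    (K : Matrix (Fin m) (BlockIndex n) ℝ)
    (W : Matrix (BlockIndex n) (BlockIndex n) ℝ) (hW : W.PosDef)
    (R : ∀ i : Fin q, Matrix (Fin (n i)) (Fin (n i)) ℝ) (hR : ∀ i, (R i).PosDef)
    (S : Matrix (Fin m) (Fin m) ℝ) (hSdiag : S.IsDiag) (hS : S.PosDef)
    (σ : Fin q → ℝ) (hσ : ∀ i, 0 < σ i) (μbar : ℝ) (hμbar : 0 < μbar)
    (Z J : Matrix (Fin m) (BlockIndex n) ℝ)
    (hIncl : ∀ i : Fin m, (inclusionLMI ubar W R Z J μbar i).PosSemidef)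
    (hM : ∀ τ ∈ timerSet T₂, (-(clockM A B K W R S σ Z J τ)).PosDef) :
    (closedLoop A B ubar T₁ T₂ K).ExponentiallyStable (attractor n T₂) ∧
    sublevelQ T₂ W R σ μbar ⊆
      (closedLoop A B ubar T₁ T₂ K).basinOfAttraction (attractor n T₂) ∧
    ∃ lam > 0, ∃ κ > 0, ∀ φ : HybridArc (ClState n),
      (closedLoop A B ubar T₁ T₂ K).IsMaximalSolution φ →
      φ.val 0 0 ∈ sublevelQ T₂ W R σ μbar →
      ∀ (t : ℝ) (j : ℕ), (t, j) ∈ φ.dom →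
        Metric.infDist (φ.val t j) (attractor n T₂) ≤
          κ * Real.exp (-lam * (t + j)) * Metric.infDist (φ.val 0 0) (attractor n T₂) := by
  obtain ⟨γ, hγ, hdec⟩ := exists_lyapunovDeriv_le hubar hW hR hSdiag hS hσ hμbar hIncl hM
  obtain ⟨lam, hlam, κ, hκ, hbound⟩ := exists_infDist_le hubar hT₁ hW hR hμbar hγ hdec
  obtain ⟨_, _, c₂, hc₂, hbd⟩ := exists_lyapunov_bounds (σ := σ) hW hR T₂
  refine ⟨⟨κ, hκ, lam, hlam, √(μbar / c₂), by positivity, fun φ hφ h0 => ?_⟩,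
    fun ξ hξ φ hφ h0 => ?_, lam, hlam, κ, hκ, fun φ hφ h0 => hbound φ hφ.1 h0.2⟩
  · have hx0 := mem_C_of_isSolution hT₁ hφ.1 0 0 φ.isHybridTimeDomain.zero_mem
    rw [infDist_attractor hx0] at h0
    have h1 := (Real.sqrt_le_sqrt_iff (by positivity)).1 h0
    rw [le_div_iff₀ hc₂] at h1
    exact ⟨isComplete_of_isMaximalSolution hubar hT₁ hT hφ,
      hbound φ hφ.1 ((hbd _ hx0).2.trans (by linarith))⟩
  · subst h0
    exact ⟨isComplete_of_isMaximalSolution hubar hT₁ hT hφ,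
      convergesTo_of_infDist_le hlam (hbound φ hφ.1 hξ.2)⟩
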